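/- **Proposition (exterior jet).** Let $X$ be a smooth Hausdorff manifold (without boundary) of dimension $n\ge 1$, let $W\to X$ be a smooth real vector bundle of finite rank, and let $k\ge 1$. For a vector bundle $V\to X$ let $J^rV$ denote the bundle of $r$-jets of smooth sections of $V$, a smooth vector bundle over $X$, and let $L(V,V')$ denote the bundle of fibrewise linear maps. All sections are smooth. For a section $\sigma$ of $L(J^{k-1}W,\wedge^{n-1}T^*X)$ and a section $\lambda$ of $J^{k-1}W$, $\sigma\cdot\lambda$ denotes the $(n-1)$-form $x\mapsto\sigma(x)(\lambda(x))$. For every section $\sigma$ of $L(J^{k-1}W,\wedge^{n-1}T^*X)$ there is a unique section $\mathfrak d\sigma$ of $L(J^1(J^{k-1}W),\wedge^{n}T^*X)$, the exterior jet of $\sigma$, such that $$\mathfrak d\sigma\cdot j^1\lambda=d(\sigma\cdot\lambda)\qquad\text{for every section }\lambda\text{ of }J^{k-1}W .$$ Moreover: 1. $\sigma\mapsto\mathfrak d\sigma$ is a linear differential operator of first order: it is $\mathbb R$-linear, and there is a smooth vector bundle morphism $D:J^1\big(L(J^{k-1}W,\wedge^{n-1}T^*X)\big)\to L(J^1(J^{k-1}W),\wedge^nT^*X)$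 over the identity of $X$ such that $\mathfrak d\sigma=D\circ j^1\sigma$ for every $\sigma$. 2. $\mathfrak d$ is natural. Let $W'\to X'$ be another such bundle over a manifold of the same dimension $n$ and let $\Phi:W\to W'$ be a smooth vector bundle map that covers a local diffeomorphism $\varphi:X\to X'$ and is an isomorphism on each fibre. If a section $\sigma$ over $X$ is the pullback by $(\Phi,\varphi)$ of a section $\sigma'$ of $L(J^{k-1}W',\wedge^{n-1}T^*X')$, then $\mathfrak d\sigma$ is the pullback of $\mathfrak d\sigma'$. Here pullback is with respect to the maps induced by $(\Phi,\varphi)$ on jets and the pullback of forms along $\varphi$. 3. Let $(x^1,\dots,x^n)$ be a chart of $X$ with domain $U$ and let $(g_\alpha)$ be a smooth frame of $W$ over $U$. For non-decreasing multi-indices $J$ with $|J|\le k-1$, let $e^\alpha_J$ be the fibrewise linear functional on $J^{k-1}W|_U$ that sends the jet of $w=w^\alpha g_\alpha$ to the partial derivative $w^\alpha_{,J}$. Let $dx=dx^1\wedge\cdots\wedge dx^n$, let $\lrcorner$ denote the contraction of a vector with a form (inserted in the first slot), and sum over repeated indices. Every $\sigma$ can be written over $U$ as $\sigma=\sigma^{Jj}_\alpha\,e^\alpha_J\otimes(\partial_j\lrcorner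 dx)$ with smooth functions $\sigma^{Jj}_\alpha$ on $U$, and then $$\mathfrak d\sigma=\big(\sigma^{Jj}_{\alpha,j}\,e^\alpha_J+\sigma^{Jj}_\alpha\,e^\alpha_J\otimes\partial_j\big)\otimes dx\quad\text{over }U,$$ that is, for every section $\lambda$ of $J^{k-1}W$ with components $\lambda^\alpha_J=e^\alpha_J(\lambda)$, $$\mathfrak d\sigma(j^1\lambda)=\big(\sigma^{Jj}_{\alpha,j}\,\lambda^\alpha_J+\sigma^{Jj}_\alpha\,\lambda^\alpha_{J,j}\big)\,dx .$$ -/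

import Mathlib

open scoped Manifold ContDiff Bundle Topology
open Bundle

noncomputable section

namespace HyperStress

/-! ### Partial derivatives and multi-indices -/

/-- The model space `ℝⁿ`. -/
abbrev Coord (n : ℕ) := EuclideanSpace ℝ (Fin n)

section Calculus

variable {n : ℕ} {F F' : Type*} [NormedAddCommGroup F] [NormedSpace ℝ F]
  [NormedAddCommGroup F'] [NormedSpace ℝ F']

/-- The partial derivative `∂f/∂yⁱ`. -/
def pderiv (i : Fin n) (f : Coord n → F) (y : Coord n) : F :=
  fderiv ℝ f y (EuclideanSpace.single i 1)

/-- The iterated partial derivative `f_{,I} = ∂_{i₁} ⋯ ∂_{iₗ} f`, for `I = i₁ ⋯ iₗ`. -/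
def multiDeriv : List (Fin n) → (Coord n → F) → Coord n → F
  | [], f => f
  | i :: I, f => pderiv i (multiDeriv I f)

/-- The non-decreasing multi-indices of length at most `r`. -/
def MultiIndex (n r : ℕ) : Type :=
  {I : List (Fin n) // I.Pairwise (· ≤ ·) ∧ I.length ≤ r}

instance (n r : ℕ) : Finite (MultiIndex n r) :=
  ((List.finite_length_le (Fin n) r).subset
    (fun _ h => h.2 : {I : List (Fin n) | I.Pairwise (· ≤ ·) ∧ I.length ≤ r} ⊆ _)).to_subtype

instance (n r : ℕ) : Fintype (MultiIndex n r) := Fintype.ofFinite _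

instance (n r : ℕ) : DecidableEq (MultiIndex n r) :=
  inferInstanceAs (DecidableEq {I : List (Fin n) // I.Pairwise (· ≤ ·) ∧ I.length ≤ r})

lemma two_le_infty : (2 : WithTop ℕ∞) ≤ ∞ := by
  exact WithTop.coe_le_coe.2 (le_top : (2 : ℕ∞) ≤ ⊤)

lemma contDiffAt_pderiv {f : Coord n → F} {y : Coord n} (hf : ContDiffAt ℝ ∞ f y) (i : Fin n) :
    ContDiffAt ℝ ∞ (pderiv i f) y :=
  (hf.fderiv_right (m := ∞) (by simp)).clm_apply contDiffAt_const

lemma contDiffAt_multiDeriv {f : Coord n → F} {y : Coord n} (hf : ContDiffAt ℝ ∞ f y)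
    (I : List (Fin n)) : ContDiffAt ℝ ∞ (multiDeriv I f) y := by
  induction I with
  | nil => exact hf
  | cons i I ih => exact contDiffAt_pderiv ih i

lemma eventually_contDiffAt {f : Coord n → F} {y : Coord n} (hf : ContDiffAt ℝ ∞ f y) :
    ∀ᶠ z in 𝓝 y, DifferentiableAt ℝ f z := by
  have : ContDiffAt ℝ 1 f y := hf.of_le (by exact_mod_cast le_top)
  exact (this.eventually (by simp)).mono fun z hz => hz.differentiableAt (by simp)

lemma pderiv_congr {f g : Coord n → F} {y : Coord n} (h : f =ᶠ[𝓝 y] g) (i : Fin n) :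
    pderiv i f =ᶠ[𝓝 y] pderiv i g :=
  h.fderiv.mono fun z hz => by
    have hz : fderiv ℝ f z = fderiv ℝ g z := hz
    simp only [pderiv, hz]

lemma multiDeriv_congr {f g : Coord n → F} {y : Coord n} (h : f =ᶠ[𝓝 y] g) (I : List (Fin n)) :
    multiDeriv I f =ᶠ[𝓝 y] multiDeriv I g := by
  induction I with
  | nil => exact h
  | cons i I ih => exact pderiv_congr ih i

lemma pderiv_add {f g : Coord n → F} {y : Coord n} (hf : ContDiffAt ℝ ∞ f y)
    (hg : ContDiffAt ℝ ∞ g y) (i : Fin n) :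
    pderiv i (f + g) =ᶠ[𝓝 y] pderiv i f + pderiv i g := by
  filter_upwards [eventually_contDiffAt hf, eventually_contDiffAt hg] with z hz hz'
  simp [pderiv, fderiv_add hz hz']

lemma multiDeriv_add {f g : Coord n → F} {y : Coord n} (hf : ContDiffAt ℝ ∞ f y)
    (hg : ContDiffAt ℝ ∞ g y) (I : List (Fin n)) :
    multiDeriv I (f + g) =ᶠ[𝓝 y] multiDeriv I f + multiDeriv I g := by
  induction I with
  | nil => rfl
  | cons i I ih =>
    exact (pderiv_congr ih i).trans
      (pderiv_add (contDiffAt_multiDeriv hf I) (contDiffAt_multiDeriv hg I) i)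

lemma multiDeriv_smul (c : ℝ) {f : Coord n → F} {y : Coord n} (hf : ContDiffAt ℝ ∞ f y)
    (I : List (Fin n)) : multiDeriv I (c • f) =ᶠ[𝓝 y] c • multiDeriv I f := by
  induction I with
  | nil => rfl
  | cons i I ih =>
    refine (pderiv_congr ih i).trans ?_
    filter_upwards [eventually_contDiffAt (contDiffAt_multiDeriv hf I)] with z hz
    simp [pderiv, multiDeriv, fderiv_const_smul hz]

lemma multiDeriv_zero (I : List (Fin n)) : multiDeriv I (0 : Coord n → F) = 0 := by
  ext y
  have := (multiDeriv_smul (0 : ℝ) (contDiffAt_const (c := (0 : F)) (x := y)) I).eq_of_nhds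
  have h0 : ((0 : ℝ) • fun _ : Coord n => (0 : F)) = 0 := by ext; simp
  rw [h0] at this
  rw [this]; simp

lemma multiDeriv_sum {ι : Type*} (s : Finset ι) {f : ι → Coord n → F} {y : Coord n}
    (hf : ∀ a, ContDiffAt ℝ ∞ (f a) y) (I : List (Fin n)) :
    multiDeriv I (fun z => ∑ a ∈ s, f a z) y = ∑ a ∈ s, multiDeriv I (f a) y := by
  classical
  induction s using Finset.induction_on with
  | empty => exact (congrFun (multiDeriv_zero (F := F) I) y).trans (by simp)
  | insert a s ha ih =>
    have h1 : (fun z => ∑ b ∈ insert a s, f b z) = f a + fun z => ∑ b ∈ s, f b z := by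
      ext z; simp [Finset.sum_insert ha]
    rw [h1, (multiDeriv_add (hf a) (ContDiffAt.sum fun b _ => hf b) I).eq_of_nhds,
      Finset.sum_insert ha, Pi.add_apply, ih]

lemma multiDeriv_perm {I J : List (Fin n)} (h : I.Perm J) {f : Coord n → F} {y : Coord n}
    (hf : ContDiffAt ℝ ∞ f y) : multiDeriv I f =ᶠ[𝓝 y] multiDeriv J f := by
  induction h with
  | nil => rfl
  | cons i _ ih => exact pderiv_congr ih i
  | swap i j I =>
    have h' := (contDiffAt_multiDeriv hf I)
    obtain ⟨u, hu, hcd⟩ : ∃ u ∈ 𝓝 y, ∀ z ∈ u,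
        fderiv ℝ (pderiv i (multiDeriv I f)) z (EuclideanSpace.single j 1) =
        fderiv ℝ (pderiv j (multiDeriv I f)) z (EuclideanSpace.single i 1) := by
      have h2 : ContDiffAt ℝ 2 (multiDeriv I f) y := h'.of_le two_le_infty
      refine ⟨_, h2.eventually (by simp), fun z hz => ?_⟩
      have hz : ContDiffAt ℝ 2 (multiDeriv I f) z := hz
      have hs : IsSymmSndFDerivAt ℝ (multiDeriv I f) z := hz.isSymmSndFDerivAt (by simp)
      have hd : DifferentiableAt ℝ (fderiv ℝ (multiDeriv I f)) z :=
        (hz.fderiv_right (m := 1) (by norm_num)).differentiableAt (by simp)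
      have key : ∀ a b : Fin n, fderiv ℝ (pderiv b (multiDeriv I f)) z (EuclideanSpace.single a 1) =
          fderiv ℝ (fderiv ℝ (multiDeriv I f)) z (EuclideanSpace.single a 1)
            (EuclideanSpace.single b 1) := by
        intro a b
        change fderiv ℝ (fun z => fderiv ℝ (multiDeriv I f) z (EuclideanSpace.single b 1)) z _ = _
        rw [fderiv_clm_apply hd (differentiableAt_const _)]
        simp
      rw [key, key]
      exact hs _ _
    filter_upwards [hu] with z hz
    exact hcd z hz
  | trans _ _ ih1 ih2 => exact ih1.trans ih2

/-- All partial derivatives of `f` of order at most `r` vanish at `y`. -/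
def Flat (r : ℕ) (f : Coord n → F) (y : Coord n) : Prop :=
  ∀ I : List (Fin n), I.length ≤ r → multiDeriv I f y = 0

lemma multiDeriv_append (I J : List (Fin n)) (f : Coord n → F) :
    multiDeriv (I ++ J) f = multiDeriv I (multiDeriv J f) := by
  induction I with
  | nil => rfl
  | cons i I ih => simp only [List.cons_append, multiDeriv, ih]

lemma Flat.mono {r r' : ℕ} (h : r' ≤ r) {f : Coord n → F} {y : Coord n} (hf : Flat r f y) :
    Flat r' f y := fun I hI => hf I (hI.trans h)

lemma Flat.pderiv {r : ℕ} {f : Coord n → F} {y : Coord n} (hf : Flat (r + 1) f y) (i : Fin n) :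
    Flat r (pderiv i f) y := fun I hI => by
  have := hf (I ++ [i]) (by simpa using hI)
  rwa [multiDeriv_append] at this

lemma Flat.congr {r : ℕ} {f g : Coord n → F} {y : Coord n} (hf : Flat r f y)
    (h : f =ᶠ[𝓝 y] g) : Flat r g y := fun I hI => by
  rw [← (multiDeriv_congr h I).eq_of_nhds]; exact hf I hI

lemma flat_of_sorted {r : ℕ} {f : Coord n → F} {y : Coord n} (hf : ContDiffAt ℝ ∞ f y)
    (h : ∀ I : MultiIndex n r, multiDeriv I.1 f y = 0) : Flat r f y := fun I hI => by
  rw [(multiDeriv_perm (List.mergeSort_perm I (· ≤ ·)).symm hf).eq_of_nhds]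
  refine h ⟨I.mergeSort (· ≤ ·), ?_, by simpa using hI⟩
  simpa using List.pairwise_mergeSort (le := fun a b : Fin n => decide (a ≤ b))
    (fun a b c => by simpa using le_trans) (fun a b => by simpa using le_total a b) I

/-- The vanishing of derivatives up to order `r` is preserved by changes of coordinates and
by linear changes of frame. -/
lemma Flat.transform {r : ℕ} : ∀ {f : Coord n → F} {ψ : Coord n → Coord n}
    {G : Coord n → F →L[ℝ] F'} {y : Coord n}, ContDiffAt ℝ ∞ f (ψ y) → ContDiffAt ℝ ∞ ψ y →
    ContDiffAt ℝ ∞ G y → Flat r f (ψ y) → Flat r (fun z => G z (f (ψ z))) y := by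
  induction r with
  | zero =>
    intro f ψ G y hf hψ hG h I hI
    obtain rfl : I = [] := by simpa using hI
    have := h [] le_rfl
    simp only [multiDeriv] at this ⊢
    simp [this]
  | succ r ih =>
    intro f ψ G y hf hψ hG h I hI
    rcases List.eq_nil_or_concat' I with rfl | ⟨L, i, rfl⟩
    · have := h [] (by simp)
      simp only [multiDeriv] at this ⊢
      simp [this]
    rw [multiDeriv_append]
    have hcoord : ∀ j, ContDiffAt ℝ ∞ (fun z => (HyperStress.pderiv i ψ z) j) y := fun j =>
      ((EuclideanSpace.proj j : Coord n →L[ℝ] ℝ).contDiff.contDiffAt).comp y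
        (contDiffAt_pderiv hψ i)
    have hfψ : ContDiffAt ℝ ∞ (fun z => f (ψ z)) y := hf.comp y hψ
    have hev : HyperStress.pderiv i (fun z => G z (f (ψ z))) =ᶠ[𝓝 y]
        (fun z => HyperStress.pderiv i G z (f (ψ z))) +
        (fun z => ∑ j, ((HyperStress.pderiv i ψ z) j • G z) (HyperStress.pderiv j f (ψ z))) := by
      filter_upwards [eventually_contDiffAt hG, eventually_contDiffAt hψ,
        hψ.continuousAt.eventually (eventually_contDiffAt hf)] with z hGz hψz hfz
      have h1 : DifferentiableAt ℝ (fun z => f (ψ z)) z := hfz.comp z hψz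
      have h2 : fderiv ℝ (fun z => f (ψ z)) z = (fderiv ℝ f (ψ z)).comp (fderiv ℝ ψ z) :=
        fderiv_comp z hfz hψz
      have h3 : HyperStress.pderiv i ψ z =
          ∑ j, (HyperStress.pderiv i ψ z) j • EuclideanSpace.single j (1 : ℝ) := by
        ext k
        simp [Pi.single_apply]
      simp only [Pi.add_apply]
      conv_lhs => rw [HyperStress.pderiv, fderiv_clm_apply hGz h1]
      simp only [add_apply, ContinuousLinearMap.comp_apply,
        ContinuousLinearMap.flip_apply, h2]
      rw [add_comm]
      congr 1
      change G z (fderiv ℝ f (ψ z) (HyperStress.pderiv i ψ z)) = _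
      conv_lhs => rw [h3]
      simp [map_sum, HyperStress.pderiv]
    change multiDeriv L (HyperStress.pderiv i fun z => G z (f (ψ z))) y = 0
    rw [(multiDeriv_congr hev L).eq_of_nhds]
    have hL : L.length ≤ r := by simpa using hI
    have c1 : ContDiffAt ℝ ∞ (fun z => HyperStress.pderiv i G z (f (ψ z))) y :=
      (contDiffAt_pderiv hG i).clm_apply hfψ
    have c2 : ∀ j, ContDiffAt ℝ ∞
        (fun z => ((HyperStress.pderiv i ψ z) j • G z) (HyperStress.pderiv j f (ψ z))) y :=
      fun j => ((hcoord j).smul hG).clm_apply ((contDiffAt_pderiv hf j).comp y hψ)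
    rw [(multiDeriv_add c1 (ContDiffAt.sum fun j _ => c2 j) L).eq_of_nhds, Pi.add_apply,
      multiDeriv_sum _ c2]
    rw [ih hf hψ (contDiffAt_pderiv hG i) (h.mono (Nat.le_succ r)) L hL, zero_add]
    refine Finset.sum_eq_zero fun j _ => ?_
    exact ih (G := fun z => (HyperStress.pderiv i ψ z) j • G z) (contDiffAt_pderiv hf j) hψ
      ((hcoord j).smul hG) (h.pderiv j) L hL

/-- The monomial `∏ᵢ (yⁱ - cⁱ)^{aᵢ} / aᵢ!`. -/
def monom (c : Coord n) (a : Fin n → ℕ) (y : Coord n) : ℝ :=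
  ∏ i, (y i - c i) ^ a i / (a i).factorial

lemma contDiff_monom (c : Coord n) (a : Fin n → ℕ) : ContDiff ℝ ∞ (monom c a) := by
  unfold monom
  refine contDiff_prod fun i _ => ?_
  have : ContDiff ℝ ∞ (fun y : Coord n => y i) :=
    (EuclideanSpace.proj i : Coord n →L[ℝ] ℝ).contDiff
  exact ((this.sub contDiff_const).pow _).div_const _

lemma pderiv_monom (c : Coord n) (a : Fin n → ℕ) (i : Fin n) :
    pderiv i (monom c a) =
      if a i = 0 then 0 else monom c (Function.update a i (a i - 1)) := by
  classical
  ext y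
  have hd : DifferentiableAt ℝ (monom c a) y :=
    (contDiff_monom c a).differentiable (by simp) y
  unfold pderiv
  rw [← hd.lineDeriv_eq_fderiv, lineDeriv]
  have h1 : (fun t : ℝ => monom c a (y + t • EuclideanSpace.single i (1 : ℝ))) = fun t =>
      ((y i - c i + t) ^ a i / (a i).factorial) *
        ∏ j ∈ Finset.univ.erase i, (y j - c j) ^ a j / (a j).factorial := by
    ext t
    rw [monom, ← Finset.mul_prod_erase _ _ (Finset.mem_univ i)]
    congr 1
    · simp; ring
    · refine Finset.prod_congr rfl fun j hj => ?_
      have : j ≠ i := Finset.ne_of_mem_erase hj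
      simp [this]
  rw [h1]
  have h2 : HasDerivAt (fun t : ℝ => (y i - c i + t) ^ a i / (a i).factorial)
      (a i * (y i - c i + 0) ^ (a i - 1) * 1 / (a i).factorial) 0 :=
    (((hasDerivAt_id (0 : ℝ)).const_add (y i - c i)).pow (a i)).div_const _
  rw [(h2.mul_const _).deriv]
  split_ifs with h0
  · simp [h0]
  · rw [monom, ← Finset.mul_prod_erase _ _ (Finset.mem_univ i)]
    congr 1
    · obtain ⟨k, hk⟩ := Nat.exists_eq_succ_of_ne_zero h0
      simp only [hk, Function.update_self, Nat.succ_eq_add_one, Nat.add_sub_cancel,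
        Nat.factorial_succ]
      push_cast
      field_simp
      simp
    · refine Finset.prod_congr rfl fun j hj => ?_
      have : j ≠ i := Finset.ne_of_mem_erase hj
      simp [this]

lemma multiDeriv_monom (c : Coord n) (I : List (Fin n)) : ∀ a : Fin n → ℕ,
    multiDeriv I (monom c a) =
      if ∀ i, I.count i ≤ a i then monom c (fun i => a i - I.count i) else 0 := by
  classical
  induction I using List.reverseRecOn with
  | nil => intro a; simp [multiDeriv]
  | append_singleton L i ih =>
    intro a
    rw [multiDeriv_append]
    change multiDeriv L (pderiv i (monom c a)) = _
    rw [pderiv_monom]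
    by_cases h0 : a i = 0
    · rw [if_pos h0, multiDeriv_zero, if_neg]
      push Not
      exact ⟨i, by simp [h0]⟩
    · rw [if_neg h0, ih]
      have e1 : (∀ j, L.count j ≤ Function.update a i (a i - 1) j) ↔
          ∀ j, (L ++ [i]).count j ≤ a j := by
        refine forall_congr' fun j => ?_
        by_cases hj : j = i
        · subst hj; simp; omega
        · simp [hj, Ne.symm hj]
      simp only [e1]
      congr 2
      ext j
      by_cases hj : j = i
      · subst hj; simp; omega
      · simp [hj, Ne.symm hj]

lemma monom_self (c : Coord n) (a : Fin n → ℕ) : monom c a c = if a = 0 then 1 else 0 := by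
  classical
  unfold monom
  split_ifs with h
  · simp [h]
  · obtain ⟨i, hi⟩ : ∃ i, a i ≠ 0 := by
      by_contra! h'; exact h (funext h')
    exact Finset.prod_eq_zero (Finset.mem_univ i) (by simp [hi])

lemma multiDeriv_monom_self {r : ℕ} (c : Coord n) (I J : MultiIndex n r) :
    multiDeriv I.1 (monom c (fun i => J.1.count i)) c = if I = J then 1 else 0 := by
  classical
  rw [multiDeriv_monom]
  by_cases h : I = J
  · subst h
    simp [monom_self]
    rfl
  rw [if_neg h]
  split_ifs with h1
  · rw [monom_self, if_neg]
    intro h2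
    apply h
    have hp : I.1.Perm J.1 := List.perm_iff_count.2 fun i =>
      le_antisymm (h1 i) (Nat.sub_eq_zero_iff_le.1 (congrFun h2 i))
    exact Subtype.ext (hp.eq_of_pairwise (fun a b _ _ hab hba => le_antisymm hab hba) I.2.1 J.2.1)
  · rfl

lemma multiDeriv_smul_const {f : Coord n → ℝ} (hf : ContDiff ℝ ∞ f) (v : F) (I : List (Fin n)) :
    multiDeriv I (fun z => f z • v) = fun z => multiDeriv I f z • v := by
  induction I with
  | nil => rfl
  | cons i I ih =>
    ext z
    have hd : DifferentiableAt ℝ (multiDeriv I f) z :=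
      (contDiffAt_multiDeriv hf.contDiffAt I).differentiableAt (by simp)
    simp only [multiDeriv, pderiv, ih]
    rw [fderiv_smul_const hd]
    simp

/-- Every array of partial derivatives is realized by a polynomial. -/
lemma exists_polynomial {r : ℕ} (c : Coord n) (p : MultiIndex n r → F) :
    ∃ f : Coord n → F, ContDiff ℝ ∞ f ∧ ∀ I : MultiIndex n r, multiDeriv I.1 f c = p I := by
  classical
  have hc : ∀ J : MultiIndex n r,
      ContDiff ℝ ∞ (fun z => monom c (fun i => J.1.count i) z • p J) :=
    fun J => (contDiff_monom c _).smul contDiff_const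
  refine ⟨fun z => ∑ J : MultiIndex n r, monom c (fun i => J.1.count i) z • p J,
    ContDiff.sum fun J _ => hc J, fun I => ?_⟩
  rw [multiDeriv_sum _ fun J => (hc J).contDiffAt]
  simp_rw [multiDeriv_smul_const (contDiff_monom c _), multiDeriv_monom_self]
  simp

end Calculus

/-! ### Jet bundles of vector bundles -/

section Jets

variable (n : ℕ) {X : Type*} [TopologicalSpace X] [ChartedSpace (Coord n) X]
  (F : Type*) [NormedAddCommGroup F] [NormedSpace ℝ F]
  (W : X → Type*) [∀ x, AddCommGroup (W x)] [∀ x, Module ℝ (W x)]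
  [∀ x, TopologicalSpace (W x)] [TopologicalSpace (TotalSpace F W)]
  [FiberBundle F W] [VectorBundle ℝ F W]

/-- The smooth sections of a vector bundle. -/
abbrev Sections := ContMDiffSection (𝓡 n) F ∞ W

variable {n F W}

/-- The representative in `ℝⁿ → F` of a section, in a chart and a local trivialization. -/
def localRep (φ : OpenPartialHomeomorph X (Coord n)) (e : Trivialization F (π F W))
    (s : ∀ x, W x) (y : Coord n) : F :=
  (e ⟨φ.symm y, s (φ.symm y)⟩).2

set_option linter.unusedSectionVars false

variable [IsManifold (𝓡 n) ∞ X] [ContMDiffVectorBundle ∞ F W (𝓡 n)]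

lemma contDiffAt_localRep {φ : OpenPartialHomeomorph X (Coord n)}
    (hφ : φ ∈ IsManifold.maximalAtlas (𝓡 n) ∞ X) (e : Trivialization F (π F W))
    [MemTrivializationAtlas e] (s : Sections n F W) {x : X} (hx : x ∈ φ.source)
    (hxe : x ∈ e.baseSet) : ContDiffAt ℝ ∞ (localRep φ e s) (φ x) := by
  rw [← contMDiffAt_iff_contDiffAt]
  have h1 : ContMDiffAt (𝓡 n) 𝓘(ℝ, F) ∞ (fun z => (e ⟨z, s z⟩).2) (φ.symm (φ x)) := by
    rw [φ.left_inv hx]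
    exact (e.contMDiffAt_section_iff hxe).1 s.contMDiff.contMDiffAt
  exact h1.comp (φ x) (contMDiffAt_symm_of_mem_maximalAtlas hφ (φ.map_source hx))

lemma contDiffAt_transition {φ φ' : OpenPartialHomeomorph X (Coord n)}
    (hφ : φ ∈ IsManifold.maximalAtlas (𝓡 n) ∞ X) (hφ' : φ' ∈ IsManifold.maximalAtlas (𝓡 n) ∞ X)
    {x : X} (hx : x ∈ φ.source) (hx' : x ∈ φ'.source) :
    ContDiffAt ℝ ∞ (fun z => φ (φ'.symm z)) (φ' x) := by
  rw [← contMDiffAt_iff_contDiffAt]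
  have h1 : ContMDiffAt (𝓡 n) (𝓡 n) ∞ φ (φ'.symm (φ' x)) := by
    rw [φ'.left_inv hx']
    exact contMDiffAt_of_mem_maximalAtlas hφ hx
  exact h1.comp (φ' x) (contMDiffAt_symm_of_mem_maximalAtlas hφ' (φ'.map_source hx'))

lemma flat_localRep_change {r : ℕ} {φ φ' : OpenPartialHomeomorph X (Coord n)}
    (hφ : φ ∈ IsManifold.maximalAtlas (𝓡 n) ∞ X) (hφ' : φ' ∈ IsManifold.maximalAtlas (𝓡 n) ∞ X)
    (e e' : Trivialization F (π F W)) [MemTrivializationAtlas e] [MemTrivializationAtlas e']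
    (s : Sections n F W) {x : X} (hx : x ∈ φ.source) (hxe : x ∈ e.baseSet)
    (hx' : x ∈ φ'.source) (hxe' : x ∈ e'.baseSet) (h : Flat r (localRep φ e s) (φ x)) :
    Flat r (localRep φ' e' s) (φ' x) := by
  have hinv : φ'.symm (φ' x) = x := φ'.left_inv hx'
  have hc : ContinuousAt φ'.symm (φ' x) := φ'.symm.continuousAt (φ'.map_source hx')
  have hG : ContDiffAt ℝ ∞
      (fun z => (e.coordChangeL ℝ e' (φ'.symm z) : F →L[ℝ] F)) (φ' x) := by
    rw [← contMDiffAt_iff_contDiffAt]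
    have h1 : ContMDiffAt (𝓡 n) 𝓘(ℝ, F →L[ℝ] F) ∞
        (fun z => (e.coordChangeL ℝ e' z : F →L[ℝ] F)) (φ'.symm (φ' x)) := by
      rw [hinv]
      exact (contMDiffOn_coordChangeL e e').contMDiffAt
        ((e.open_baseSet.inter e'.open_baseSet).mem_nhds ⟨hxe, hxe'⟩)
    exact h1.comp (φ' x) (contMDiffAt_symm_of_mem_maximalAtlas hφ' (φ'.map_source hx'))
  have h2 : φ (φ'.symm (φ' x)) = φ x := by rw [hinv]
  have key := Flat.transform (r := r) (f := localRep φ e s) (ψ := fun z => φ (φ'.symm z))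
    (y := φ' x) (by rw [h2]; exact contDiffAt_localRep hφ e s hx hxe)
    (contDiffAt_transition hφ hφ' hx hx') hG (by rw [h2]; exact h)
  refine key.congr ?_
  have hU : φ.source ∩ (e.baseSet ∩ e'.baseSet) ∈ 𝓝 (φ'.symm (φ' x)) := by
    rw [hinv]
    exact (φ.open_source.inter (e.open_baseSet.inter e'.open_baseSet)).mem_nhds ⟨hx, hxe, hxe'⟩
  filter_upwards [hc hU] with z hz
  simp only [localRep]
  rw [φ.left_inv hz.1]
  refine (e.coordChangeL_apply e' hz.2 _).trans ?_
  rw [e.symm_apply_apply_mk hz.2.1 (s (φ'.symm z))]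

lemma multiDeriv_localRep_add {φ : OpenPartialHomeomorph X (Coord n)}
    (hφ : φ ∈ IsManifold.maximalAtlas (𝓡 n) ∞ X) (e : Trivialization F (π F W))
    [MemTrivializationAtlas e] (s t : Sections n F W) {x : X} (hx : x ∈ φ.source)
    (hxe : x ∈ e.baseSet) (I : List (Fin n)) :
    multiDeriv I (localRep φ e (s + t : Sections n F W)) (φ x) =
      multiDeriv I (localRep φ e s) (φ x) + multiDeriv I (localRep φ e t) (φ x) := by
  have hc : ContinuousAt φ.symm (φ x) := φ.symm.continuousAt (φ.map_source hx)
  have hev : localRep φ e (s + t : Sections n F W) =ᶠ[𝓝 (φ x)]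
      localRep φ e s + localRep φ e t := by
    have hU : e.baseSet ∈ 𝓝 (φ.symm (φ x)) := by
      rw [φ.left_inv hx]; exact e.open_baseSet.mem_nhds hxe
    filter_upwards [hc hU] with z hz
    exact (e.linear ℝ hz).map_add _ _
  rw [(multiDeriv_congr hev I).eq_of_nhds, (multiDeriv_add (contDiffAt_localRep hφ e s hx hxe)
    (contDiffAt_localRep hφ e t hx hxe) I).eq_of_nhds, Pi.add_apply]

lemma multiDeriv_localRep_smul {φ : OpenPartialHomeomorph X (Coord n)}
    (hφ : φ ∈ IsManifold.maximalAtlas (𝓡 n) ∞ X) (e : Trivialization F (π F W))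
    [MemTrivializationAtlas e] (c : ℝ) (s : Sections n F W) {x : X} (hx : x ∈ φ.source)
    (hxe : x ∈ e.baseSet) (I : List (Fin n)) :
    multiDeriv I (localRep φ e (c • s : Sections n F W)) (φ x) =
      c • multiDeriv I (localRep φ e s) (φ x) := by
  have hc : ContinuousAt φ.symm (φ x) := φ.symm.continuousAt (φ.map_source hx)
  have hev : localRep φ e (c • s : Sections n F W) =ᶠ[𝓝 (φ x)] c • localRep φ e s := by
    have hU : e.baseSet ∈ 𝓝 (φ.symm (φ x)) := by
      rw [φ.left_inv hx]; exact e.open_baseSet.mem_nhds hxe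
    filter_upwards [hc hU] with z hz
    exact (e.linear ℝ hz).map_smul _ _
  rw [(multiDeriv_congr hev I).eq_of_nhds,
    (multiDeriv_smul c (contDiffAt_localRep hφ e s hx hxe) I).eq_of_nhds, Pi.smul_apply]

lemma chart_mem (x : X) :
    chartAt (Coord n) x ∈ IsManifold.maximalAtlas (𝓡 n) ∞ X :=
  IsManifold.chart_mem_maximalAtlas x

variable (n F W) in
/-- The sections whose partial derivatives of order at most `r` all vanish at `x`. -/
def vanishing (r : ℕ) (x : X) : Submodule ℝ (Sections n F W) where
  carrier := {s | Flat r (localRep (chartAt (Coord n) x) (trivializationAt F W x) s)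
    (chartAt (Coord n) x x)}
  add_mem' {s t} hs ht := fun I hI => by
    rw [multiDeriv_localRep_add (chart_mem x) _ s t (mem_chart_source _ x)
      (mem_baseSet_trivializationAt F W x), hs I hI, ht I hI, add_zero]
  zero_mem' := fun I _ => by
    have := multiDeriv_localRep_smul (chart_mem x) (trivializationAt F W x) 0
      (0 : Sections n F W) (mem_chart_source _ x) (mem_baseSet_trivializationAt F W x) I
    rwa [zero_smul, zero_smul] at this
  smul_mem' c s hs := fun I hI => by
    rw [multiDeriv_localRep_smul (chart_mem x) _ c s (mem_chart_source _ x)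
      (mem_baseSet_trivializationAt F W x), hs I hI, smul_zero]

variable (n F W) in
/-- The fibre at `x` of the `r`-jet bundle `Jʳ W`: smooth sections of `W` modulo those whose
derivatives of order at most `r` all vanish at `x`. (On a Hausdorff manifold every local section
agrees near `x` with a global one, so these are also the `r`-jets of local sections.) -/
def JetBundle (r : ℕ) (x : X) : Type _ := Sections n F W ⧸ vanishing n F W r x

instance (r : ℕ) (x : X) : AddCommGroup (JetBundle n F W r x) :=
  inferInstanceAs (AddCommGroup (Sections n F W ⧸ vanishing n F W r x))

instance (r : ℕ) (x : X) : Module ℝ (JetBundle n F W r x) :=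
  inferInstanceAs (Module ℝ (Sections n F W ⧸ vanishing n F W r x))

/-- The `r`-jet at `x` of a section. -/
def jetAt (r : ℕ) (x : X) : Sections n F W →ₗ[ℝ] JetBundle n F W r x :=
  (vanishing n F W r x).mkQ

lemma jetAt_surjective (r : ℕ) (x : X) :
    Function.Surjective (jetAt r x : Sections n F W → JetBundle n F W r x) :=
  Submodule.mkQ_surjective _

/-- A section representing a given jet. -/
def jetRepr {r : ℕ} {x : X} (p : JetBundle n F W r x) : Sections n F W :=
  Function.surjInv (jetAt_surjective r x) p

lemma jetAt_jetRepr {r : ℕ} {x : X} (p : JetBundle n F W r x) : jetAt r x (jetRepr p) = p :=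
  Function.surjInv_eq _ p

/-- The typical fibre of `Jʳ W`: arrays indexed by the non-decreasing multi-indices of length
at most `r`, with values in the typical fibre of `W`. -/
abbrev JetModel (n r : ℕ) (F : Type*) := MultiIndex n r → F

/-- The array of partial derivatives `(w_{,I})_I` at `x` of the jet of a section `w`,
in a chart and a local trivialization. -/
def jetCoord {r : ℕ} (φ : OpenPartialHomeomorph X (Coord n)) (e : Trivialization F (π F W)) (x : X)
    (p : JetBundle n F W r x) : JetModel n r F :=
  fun I => multiDeriv I.1 (localRep φ e (jetRepr p)) (φ x)

lemma jetAt_eq_zero_iff {r : ℕ} {φ : OpenPartialHomeomorph X (Coord n)}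
    (hφ : φ ∈ IsManifold.maximalAtlas (𝓡 n) ∞ X) (e : Trivialization F (π F W))
    [MemTrivializationAtlas e] (s : Sections n F W) {x : X} (hx : x ∈ φ.source)
    (hxe : x ∈ e.baseSet) :
    jetAt r x s = 0 ↔ ∀ I : MultiIndex n r, multiDeriv I.1 (localRep φ e s) (φ x) = 0 := by
  have h0 : jetAt r x s = 0 ↔ s ∈ vanishing n F W r x :=
    Submodule.Quotient.mk_eq_zero _
  rw [h0]
  constructor
  · intro h I
    exact flat_localRep_change (chart_mem x) hφ (trivializationAt F W x) e s
      (mem_chart_source _ x) (mem_baseSet_trivializationAt F W x) hx hxe h I.1 I.2.2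
  · intro h
    exact flat_localRep_change hφ (chart_mem x) e (trivializationAt F W x) s hx hxe
      (mem_chart_source _ x) (mem_baseSet_trivializationAt F W x)
      (flat_of_sorted (contDiffAt_localRep hφ e s hx hxe) h)

lemma jetCoord_jetAt {r : ℕ} {φ : OpenPartialHomeomorph X (Coord n)}
    (hφ : φ ∈ IsManifold.maximalAtlas (𝓡 n) ∞ X) (e : Trivialization F (π F W))
    [MemTrivializationAtlas e] (s : Sections n F W) {x : X} (hx : x ∈ φ.source)
    (hxe : x ∈ e.baseSet) (I : MultiIndex n r) :
    jetCoord φ e x (jetAt r x s) I = multiDeriv I.1 (localRep φ e s) (φ x) := by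
  set t := jetRepr (jetAt r x s) with ht
  have h1 : jetAt r x (t + (-1 : ℝ) • s) = 0 := by
    rw [map_add, map_smul, ht, jetAt_jetRepr]; simp
  have h2 := (jetAt_eq_zero_iff hφ e _ hx hxe).1 h1 I
  rw [multiDeriv_localRep_add hφ e _ _ hx hxe, multiDeriv_localRep_smul hφ e _ _ hx hxe] at h2
  change multiDeriv I.1 (localRep φ e t) (φ x) = _
  simpa [add_neg_eq_zero] using h2

lemma exists_section [T2Space X] {φ : OpenPartialHomeomorph X (Coord n)}
    (hφ : φ ∈ IsManifold.maximalAtlas (𝓡 n) ∞ X) (e : Trivialization F (π F W))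
    [MemTrivializationAtlas e] {x : X} (hx : x ∈ φ.source)
    (hxe : x ∈ e.baseSet) {f : Coord n → F} (hf : ContDiff ℝ ∞ f) :
    ∃ s : Sections n F W, localRep φ e s =ᶠ[𝓝 (φ x)] f := by
  have hUo : IsOpen (φ.source ∩ e.baseSet) := φ.open_source.inter e.open_baseSet
  obtain ⟨b, -, hb⟩ := (SmoothBumpFunction.nhds_basis_tsupport (I := 𝓡 n) x).mem_iff.1
    (hUo.mem_nhds ⟨hx, hxe⟩)
  set t : ∀ z, W z := fun z => e.symm z (f (φ z)) with ht
  have hts : ContMDiffOn (𝓡 n) ((𝓡 n).prod 𝓘(ℝ, F)) ∞ (fun z => TotalSpace.mk' F z (t z))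
      (φ.source ∩ e.baseSet) := by
    rw [e.contMDiffOn_section_iff hUo Set.inter_subset_right]
    have h1 : ContMDiffOn (𝓡 n) 𝓘(ℝ, F) ∞ (fun z => f (φ z)) (φ.source ∩ e.baseSet) :=
      hf.contMDiff.comp_contMDiffOn
        ((contMDiffOn_of_mem_maximalAtlas hφ).mono Set.inter_subset_left)
    refine h1.congr fun z hz => ?_
    rw [e.apply_mk_symm hz.2]
  refine ⟨⟨(b : X → ℝ) • t, ContMDiffOn.smul_section_of_tsupport b.contMDiff.contMDiffOn hUo
    hb hts⟩, ?_⟩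
  have hc : ContinuousAt φ.symm (φ x) := φ.symm.continuousAt (φ.map_source hx)
  have h1 : {z | b z = 1} ∩ (φ.source ∩ e.baseSet) ∈ 𝓝 (φ.symm (φ x)) := by
    rw [φ.left_inv hx]
    exact Filter.inter_mem b.eventuallyEq_one (hUo.mem_nhds ⟨hx, hxe⟩)
  filter_upwards [hc h1, φ.open_target.mem_nhds (φ.map_source hx)] with z hz hzt
  have hz1 : b (φ.symm z) = 1 := hz.1
  change (e ⟨φ.symm z, b (φ.symm z) • e.symm (φ.symm z) (f (φ (φ.symm z)))⟩).2 = f z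
  rw [hz1, one_smul, e.apply_mk_symm hz.2.2, φ.right_inv hzt]

/-- The linear isomorphism between the jets at `x` and the arrays of partial derivatives. -/
def jetCoordEquiv [T2Space X] (r : ℕ) {φ : OpenPartialHomeomorph X (Coord n)}
    (hφ : φ ∈ IsManifold.maximalAtlas (𝓡 n) ∞ X) (e : Trivialization F (π F W))
    [MemTrivializationAtlas e] {x : X} (hx : x ∈ φ.source) (hxe : x ∈ e.baseSet) :
    JetBundle n F W r x ≃ₗ[ℝ] JetModel n r F :=
  LinearEquiv.ofBijective
    { toFun := jetCoord φ e x
      map_add' := fun p q => by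
        obtain ⟨s, rfl⟩ := jetAt_surjective r x p
        obtain ⟨t, rfl⟩ := jetAt_surjective r x q
        ext I
        rw [← map_add, Pi.add_apply, jetCoord_jetAt hφ e _ hx hxe, jetCoord_jetAt hφ e _ hx hxe,
          jetCoord_jetAt hφ e _ hx hxe, multiDeriv_localRep_add hφ e _ _ hx hxe]
      map_smul' := fun c p => by
        obtain ⟨s, rfl⟩ := jetAt_surjective r x p
        ext I
        rw [← map_smul, Pi.smul_apply, jetCoord_jetAt hφ e _ hx hxe,
          jetCoord_jetAt hφ e _ hx hxe, multiDeriv_localRep_smul hφ e _ _ hx hxe]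
        rfl } <| by
    constructor
    · rw [injective_iff_map_eq_zero]
      intro p hp
      obtain ⟨s, rfl⟩ := jetAt_surjective r x p
      refine (jetAt_eq_zero_iff hφ e s hx hxe).2 fun I => ?_
      rw [← jetCoord_jetAt hφ e s hx hxe]
      exact congrFun hp I
    · intro v
      obtain ⟨f, hf, hfv⟩ := exists_polynomial (φ x) v
      obtain ⟨s, hs⟩ := exists_section hφ e hx hxe hf
      refine ⟨jetAt r x s, ?_⟩
      ext I
      refine (jetCoord_jetAt hφ e s hx hxe I).trans ?_
      rw [(multiDeriv_congr hs I.1).eq_of_nhds, hfv]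

lemma contMDiffAt_jetCoord {r : ℕ} {φ : OpenPartialHomeomorph X (Coord n)}
    (hφ : φ ∈ IsManifold.maximalAtlas (𝓡 n) ∞ X) (e : Trivialization F (π F W))
    [MemTrivializationAtlas e] (s : Sections n F W) {x : X} (hx : x ∈ φ.source)
    (hxe : x ∈ e.baseSet) :
    ContMDiffAt (𝓡 n) 𝓘(ℝ, JetModel n r F) ∞ (fun z => jetCoord φ e z (jetAt r z s)) x := by
  have h1 : ContDiffAt ℝ ∞ (fun y (I : MultiIndex n r) => multiDeriv I.1 (localRep φ e s) y)
      (φ x) := contDiffAt_pi.2 fun I => contDiffAt_multiDeriv (contDiffAt_localRep hφ e s hx hxe) _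
  have h2 := h1.contMDiffAt.comp x (contMDiffAt_of_mem_maximalAtlas hφ hx)
  refine h2.congr_of_eventuallyEq ?_
  filter_upwards [(φ.open_source.inter e.open_baseSet).mem_nhds ⟨hx, hxe⟩] with z hz
  ext I
  exact jetCoord_jetAt hφ e s hz.1 hz.2 I

/-- The local trivialization of `Jʳ W` given by a chart of the base and a local trivialization
of `W`: a jet is sent to its array of partial derivatives. -/
def jetPretriv [T2Space X] (r : ℕ) {φ : OpenPartialHomeomorph X (Coord n)}
    (hφ : φ ∈ IsManifold.maximalAtlas (𝓡 n) ∞ X) (e : Trivialization F (π F W))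
    [MemTrivializationAtlas e] :
    Pretrivialization (JetModel n r F) (π (JetModel n r F) (JetBundle n F W r)) where
  toFun p := (p.1, jetCoord φ e p.1 p.2)
  invFun p := ⟨p.1, Function.invFun (jetCoord φ e p.1) p.2⟩
  source := TotalSpace.proj ⁻¹' (φ.source ∩ e.baseSet)
  target := (φ.source ∩ e.baseSet) ×ˢ Set.univ
  map_source' _ h := ⟨h, Set.mem_univ _⟩
  map_target' _ h := h.1
  left_inv' := by
    rintro ⟨x, p⟩ ⟨hx, hxe⟩
    simp only [TotalSpace.mk_inj]
    exact Function.leftInverse_invFun (jetCoordEquiv r hφ e hx hxe).injective p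
  right_inv' := by
    rintro ⟨x, v⟩ ⟨⟨hx, hxe⟩, -⟩
    simp only [Prod.mk_right_inj]
    exact Function.invFun_eq ((jetCoordEquiv r hφ e hx hxe).surjective v)
  open_target := (φ.open_source.inter e.open_baseSet).prod isOpen_univ
  baseSet := φ.source ∩ e.baseSet
  open_baseSet := φ.open_source.inter e.open_baseSet
  source_eq := rfl
  target_eq := rfl
  proj_toFun _ _ := rfl

instance jetPretriv_isLinear [T2Space X] (r : ℕ) {φ : OpenPartialHomeomorph X (Coord n)}
    (hφ : φ ∈ IsManifold.maximalAtlas (𝓡 n) ∞ X) (e : Trivialization F (π F W))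
    [MemTrivializationAtlas e] : (jetPretriv r hφ e).IsLinear ℝ where
  linear _ hx :=
    { map_add := (jetCoordEquiv r hφ e hx.1 hx.2).map_add
      map_smul := (jetCoordEquiv r hφ e hx.1 hx.2).map_smul }

lemma exists_jetCoordChange [T2Space X] [FiniteDimensional ℝ F] (r : ℕ)
    {φ φ' : OpenPartialHomeomorph X (Coord n)}
    (hφ : φ ∈ IsManifold.maximalAtlas (𝓡 n) ∞ X) (hφ' : φ' ∈ IsManifold.maximalAtlas (𝓡 n) ∞ X)
    (e e' : Trivialization F (π F W)) [MemTrivializationAtlas e] [MemTrivializationAtlas e'] :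
    ∃ f : X → JetModel n r F →L[ℝ] JetModel n r F,
      ContMDiffOn (𝓡 n) 𝓘(ℝ, JetModel n r F →L[ℝ] JetModel n r F) ∞ f
        ((jetPretriv r hφ e).baseSet ∩ (jetPretriv r hφ' e').baseSet) ∧
      ∀ x ∈ (jetPretriv r hφ e).baseSet ∩ (jetPretriv r hφ' e').baseSet, ∀ v : JetModel n r F,
        f x v = (jetPretriv r hφ' e' ⟨x, (jetPretriv r hφ e).symm x v⟩).2 := by
  classical
  let B : Set X := (φ.source ∩ e.baseSet) ∩ (φ'.source ∩ e'.baseSet)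
  change ∃ f : X → JetModel n r F →L[ℝ] JetModel n r F,
    ContMDiffOn (𝓡 n) 𝓘(ℝ, JetModel n r F →L[ℝ] JetModel n r F) ∞ f B ∧ ∀ x ∈ B, ∀ v, _
  have hBo : IsOpen B := (φ.open_source.inter e.open_baseSet).inter
    (φ'.open_source.inter e'.open_baseSet)
  have hval : ∀ x (hx : x ∈ B) (v : JetModel n r F),
      (jetPretriv r hφ' e' ⟨x, (jetPretriv r hφ e).symm x v⟩).2 =
        jetCoordEquiv r hφ' e' hx.2.1 hx.2.2 ((jetCoordEquiv r hφ e hx.1.1 hx.1.2).symm v) := by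
    intro x hx v
    have h1 : (jetPretriv r hφ e).symm x v = (jetCoordEquiv r hφ e hx.1.1 hx.1.2).symm v := by
      rw [LinearEquiv.eq_symm_apply]
      have := (jetPretriv (n := n) (F := F) (W := W) r hφ e).apply_mk_symm hx.1 v
      exact congrArg Prod.snd this
    rw [h1]
    rfl
  refine ⟨fun x => if hx : x ∈ B then LinearMap.toContinuousLinearMap
    (((jetCoordEquiv (W := W) r hφ e hx.1.1 hx.1.2).symm.trans
      (jetCoordEquiv r hφ' e' hx.2.1 hx.2.2)) : JetModel n r F →ₗ[ℝ] JetModel n r F) else 0,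
    ?_, fun x hx v => ?_⟩
  swap
  · rw [hval x hx v]
    simp only [dif_pos hx]
    rfl
  intro x hx
  refine ContMDiffAt.contMDiffWithinAt ?_
  -- a linear family of sections with prescribed jets at `x`
  have hsurj : LinearMap.range ((jetCoordEquiv (W := W) r hφ e hx.1.1 hx.1.2).toLinearMap ∘ₗ
      jetAt r x) = ⊤ := by
    rw [LinearMap.range_eq_top]
    exact (jetCoordEquiv (W := W) r hφ e hx.1.1 hx.1.2).surjective.comp (jetAt_surjective r x)
  obtain ⟨S, hS⟩ := LinearMap.exists_rightInverse_of_surjective _ hsurj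
  have hmat : ∀ {φ₁ : OpenPartialHomeomorph X (Coord n)}
      (hφ₁ : φ₁ ∈ IsManifold.maximalAtlas (𝓡 n) ∞ X) (e₁ : Trivialization F (π F W))
      [MemTrivializationAtlas e₁], x ∈ φ₁.source → x ∈ e₁.baseSet →
      ∃ M : X → JetModel n r F →L[ℝ] JetModel n r F,
        ContMDiffAt (𝓡 n) 𝓘(ℝ, JetModel n r F →L[ℝ] JetModel n r F) ∞ M x ∧
        ∀ z ∈ φ₁.source ∩ e₁.baseSet, ∀ v, M z v = jetCoord φ₁ e₁ z (jetAt r z (S v)) := by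
    intro φ₁ hφ₁ e₁ _ h1 h2
    let b := Module.finBasis ℝ (JetModel n r F)
    let bc : Fin (Module.finrank ℝ (JetModel n r F)) → JetModel n r F →L[ℝ] ℝ :=
      fun i => LinearMap.toContinuousLinearMap (b.coord i)
    refine ⟨fun z => ∑ i, (bc i).smulRight (jetCoord φ₁ e₁ z (jetAt r z (S (b i)))), ?_, ?_⟩
    · refine ContMDiffAt.sum fun i _ => ?_
      have h3 := contMDiffAt_jetCoord (r := r) hφ₁ e₁ (S (b i)) h1 h2
      exact ((ContinuousLinearMap.smulRightL ℝ (JetModel n r F) (JetModel n r F)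
        (bc i)).contDiff.contMDiff.contMDiffAt).comp x h3
    · intro z hz v
      have h4 : ∀ s, jetCoord φ₁ e₁ z (jetAt r z s) =
        jetCoordEquiv r hφ₁ e₁ hz.1 hz.2 (jetAt r z s) := fun s => rfl
      have h5 := congrArg ((jetCoordEquiv (W := W) r hφ₁ e₁ hz.1 hz.2).toLinearMap ∘ₗ
        jetAt r z ∘ₗ S) (b.sum_repr v)
      rw [map_sum] at h5
      refine Eq.trans ?_ h5
      simp [h4, bc]
  obtain ⟨M, hM, hMv⟩ := hmat hφ e hx.1.1 hx.1.2
  obtain ⟨M', hM', hMv'⟩ := hmat hφ' e' hx.2.1 hx.2.2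
  have hMx : M x = 1 := by
    ext1 v
    rw [hMv x hx.1]
    exact LinearMap.congr_fun hS v
  have hinv : ContMDiffAt (𝓡 n) 𝓘(ℝ, JetModel n r F →L[ℝ] JetModel n r F) ∞
      (fun z => Ring.inverse (M z)) x := by
    have h1 : ContDiffAt ℝ ∞ (Ring.inverse : (JetModel n r F →L[ℝ] JetModel n r F) → _) (M x) := by
      rw [hMx]
      exact contDiffAt_ringInverse ℝ (1 : (JetModel n r F →L[ℝ] JetModel n r F)ˣ)
    exact h1.contMDiffAt.comp x hM
  have hunit : ∀ᶠ z in 𝓝 x, IsUnit (M z) := by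
    have : IsUnit (M x) := by rw [hMx]; exact isUnit_one
    exact hM.continuousAt.eventually (Units.isOpen.mem_nhds this)
  refine (hM'.clm_comp hinv).congr_of_eventuallyEq ?_
  filter_upwards [hunit, hBo.mem_nhds hx] with z hu hz
  rw [dif_pos hz]
  ext1 v
  obtain ⟨u, rfl⟩ : ∃ u, v = M z u := ⟨Ring.inverse (M z) v, by
    rw [← mul_apply_eq_comp, Ring.mul_inverse_cancel _ hu]; rfl⟩
  rw [ContinuousLinearMap.comp_apply, ← mul_apply_eq_comp (Ring.inverse (M z)),
    Ring.inverse_mul_cancel _ hu, one_apply_eq_self, hMv' z hz.2, hMv z hz.1]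
  change jetCoordEquiv r hφ' e' hz.2.1 hz.2.2 ((jetCoordEquiv r hφ e hz.1.1 hz.1.2).symm
    (jetCoordEquiv r hφ e hz.1.1 hz.1.2 (jetAt r z (S u)))) = _
  rw [LinearEquiv.symm_apply_apply]
  rfl

/-- The topology of the fibre `Jʳₓ W`, as a finite-dimensional space. -/
instance (r : ℕ) (x : X) : TopologicalSpace (JetBundle n F W r x) :=
  TopologicalSpace.induced (jetCoord (chartAt (Coord n) x) (trivializationAt F W x) x)
    inferInstance

variable (n F W) in
/-- The vector prebundle structure of `Jʳ W`, given by all the local trivializations above. -/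
def jetPrebundle [T2Space X] [FiniteDimensional ℝ F] (r : ℕ) :
    VectorPrebundle ℝ (JetModel n r F) (JetBundle n F W r) where
  pretrivializationAtlas := {p | ∃ (φ : OpenPartialHomeomorph X (Coord n))
    (hφ : φ ∈ IsManifold.maximalAtlas (𝓡 n) ∞ X) (e : Trivialization F (π F W))
    (_ : MemTrivializationAtlas e), p = jetPretriv r hφ e}
  pretrivialization_linear' := by
    rintro _ ⟨φ, hφ, e, he, rfl⟩
    infer_instance
  pretrivializationAt x := jetPretriv r (chart_mem x) (trivializationAt F W x)
  mem_base_pretrivializationAt x :=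
    ⟨mem_chart_source _ x, mem_baseSet_trivializationAt F W x⟩
  pretrivialization_mem_atlas x :=
    ⟨_, chart_mem x, trivializationAt F W x, inferInstance, rfl⟩
  exists_coordChange := by
    rintro _ ⟨φ, hφ, e, he, rfl⟩ _ ⟨φ', hφ', e', he', rfl⟩
    obtain ⟨f, hf, hf'⟩ := exists_jetCoordChange r hφ hφ' e e'
    exact ⟨f, hf.continuousOn, hf'⟩
  totalSpaceMk_isInducing x :=
    (Topology.isInducing_const_prod (x := x)).2 ⟨rfl⟩

section

variable [T2Space X] [FiniteDimensional ℝ F]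

instance (r : ℕ) : TopologicalSpace (TotalSpace (JetModel n r F) (JetBundle n F W r)) :=
  (jetPrebundle n F W r).totalSpaceTopology

instance (r : ℕ) : FiberBundle (JetModel n r F) (JetBundle n F W r) :=
  (jetPrebundle n F W r).toFiberBundle

instance (r : ℕ) : VectorBundle ℝ (JetModel n r F) (JetBundle n F W r) :=
  (jetPrebundle n F W r).toVectorBundle

instance (r : ℕ) : (jetPrebundle n F W r).IsContMDiff (𝓡 n) ∞ where
  exists_contMDiffCoordChange := by
    rintro _ ⟨φ, hφ, e, he, rfl⟩ _ ⟨φ', hφ', e', he', rfl⟩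
    exact exists_jetCoordChange r hφ hφ' e e'

instance (r : ℕ) : ContMDiffVectorBundle ∞ (JetModel n r F) (JetBundle n F W r) (𝓡 n) :=
  (jetPrebundle n F W r).contMDiffVectorBundle (𝓡 n)

/-- The `r`-jet extension `jʳ s` of a section `s`. -/
def jet (r : ℕ) (s : Sections n F W) : Sections n (JetModel n r F) (JetBundle n F W r) where
  toFun x := jetAt r x s
  contMDiff_toFun x := by
    have h := contMDiffAt_jetCoord (r := r) (chart_mem x) (trivializationAt F W x) s
      (mem_chart_source _ x) (mem_baseSet_trivializationAt F W x)
    exact (Bundle.contMDiffAt_section x).2 h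

end

end Jets

/-! ### Bundles of exterior forms and the exterior derivative -/

section Forms

/-- The space of alternating `d`-forms on `ℝⁿ`. -/
abbrev FormModel (n d : ℕ) := Coord n [⋀^Fin d]→L[ℝ] ℝ

instance (n d : ℕ) : FiniteDimensional ℝ (FormModel n d) := by
  let T : FormModel n d →ₗ[ℝ] MultilinearMap ℝ (fun _ : Fin d => Coord n) ℝ :=
    { toFun := fun f => f.toAlternatingMap.toMultilinearMap
      map_add' := fun _ _ => rfl
      map_smul' := fun _ _ => rfl }
  refine FiniteDimensional.of_injective T fun f g h => ?_
  ext v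
  exact congrArg (fun k : MultilinearMap ℝ (fun _ : Fin d => Coord n) ℝ => k v) h

lemma contDiff_compMultilinear (d : ℕ) (E G : Type*) [NormedAddCommGroup E] [NormedSpace ℝ E]
    [NormedAddCommGroup G] [NormedSpace ℝ G] :
    ContDiff ℝ ∞ (ContinuousMultilinearMap.compContinuousLinearMapContinuousMultilinear ℝ
      (fun _ : Fin d => E) (fun _ : Fin d => E) G) := ContinuousMultilinearMap.contDiff _

lemma contDiff_compAlternating (d : ℕ) (E G : Type*) [NormedAddCommGroup E] [NormedSpace ℝ E]
    [NormedAddCommGroup G] [NormedSpace ℝ G] :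
    ContDiff ℝ ∞ (ContinuousLinearMap.compContinuousAlternatingMapCLM (ι := Fin d) ℝ E G G) :=
  ContinuousLinearMap.contDiff _

lemma contDiff_pullbackForm (n d : ℕ) :
    ContDiff ℝ ∞ (ContinuousAlternatingMap.compContinuousLinearMapCLM :
      (Coord n →L[ℝ] Coord n) → FormModel n d →L[ℝ] FormModel n d) := by
  have hfin : FiniteDimensional ℝ (ContinuousMultilinearMap ℝ (fun _ : Fin d => Coord n) ℝ) := by
    let T : ContinuousMultilinearMap ℝ (fun _ : Fin d => Coord n) ℝ →ₗ[ℝ]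
        MultilinearMap ℝ (fun _ : Fin d => Coord n) ℝ :=
      { toFun := fun f => f.toMultilinearMap
        map_add' := fun _ _ => rfl
        map_smul' := fun _ _ => rfl }
    refine FiniteDimensional.of_injective T fun f g h => ?_
    ext v
    exact congrArg (fun k : MultilinearMap ℝ (fun _ : Fin d => Coord n) ℝ => k v) h
  let J := (ContinuousAlternatingMap.toContinuousMultilinearMapLI (𝕜 := ℝ) (E := Coord n)
    (F := ℝ) (ι := Fin d))
  obtain ⟨L, hL⟩ := LinearMap.exists_leftInverse_of_injective J.toLinearMap
    (LinearMap.ker_eq_bot.2 J.injective)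
  let L' := LinearMap.toContinuousLinearMap L
  let C := ContinuousMultilinearMap.compContinuousLinearMapContinuousMultilinear ℝ
    (fun _ : Fin d => Coord n) (fun _ : Fin d => Coord n) ℝ
  have hC : ContDiff ℝ ∞ (fun f : Coord n →L[ℝ] Coord n => C fun _ => f) :=
    (contDiff_compMultilinear d (Coord n) ℝ).comp (contDiff_pi.2 fun _ => contDiff_id)
  have h : ContDiff ℝ ∞ (fun f : Coord n →L[ℝ] Coord n =>
      L'.comp ((C fun _ => f).comp J.toContinuousLinearMap)) :=
    contDiff_const.clm_comp (hC.clm_comp contDiff_const)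
  convert! h using 1
  ext1 f
  ext1 θ
  have h1 : J (θ.compContinuousLinearMap f) = C (fun _ => f) (J θ) := rfl
  have h2 := LinearMap.congr_fun hL (θ.compContinuousLinearMap f)
  change θ.compContinuousLinearMap f = L (C (fun _ => f) (J θ))
  rw [← h1]
  exact h2.symm

variable {n : ℕ} {X : Type*} [TopologicalSpace X] [ChartedSpace (Coord n) X]

/-- The fibre at `x` of the bundle `⋀ᵈ T*X`. -/
abbrev FormBundle (n d : ℕ) {X : Type*} [TopologicalSpace X] [ChartedSpace (Coord n) X] (x : X) :=
  TangentSpace (𝓡 n) x [⋀^Fin d]→L[ℝ] Bundle.Trivial X ℝ x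

instance [IsManifold (𝓡 n) ∞ X] (d : ℕ) :
    (Bundle.ContinuousAlternatingMap.vectorPrebundle ℝ (Fin d) (Coord n)
      (TangentSpace (𝓡 n) : X → Type _) ℝ (Bundle.Trivial X ℝ)).IsContMDiff (𝓡 n) ∞ where
  exists_contMDiffCoordChange := by
    rintro _ ⟨e₁, e₂, he₁, he₂, rfl⟩ _ ⟨e₁', e₂', he₁', he₂', rfl⟩
    refine ⟨Bundle.Pretrivialization.continuousAlternatingMapCoordChange ℝ (Fin d) e₁ e₁' e₂ e₂',
      ?_, Bundle.Pretrivialization.continuousAlternatingMapCoordChange_apply⟩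
    have h1 := contMDiffOn_coordChangeL (IB := 𝓡 n) (n := ∞) e₁' e₁
    have h2 := contMDiffOn_coordChangeL (IB := 𝓡 n) (n := ∞) e₂ e₂'
    have h3 := (contDiff_pullbackForm n d).contMDiff.comp_contMDiffOn h1
    have h4 := (contDiff_compAlternating d (Coord n) ℝ).contMDiff.comp_contMDiffOn h2
    exact (h4.mono fun b hb => ⟨hb.1.2, hb.2.2⟩).clm_comp
      (h3.mono fun b hb => ⟨hb.2.1, hb.1.1⟩)

instance [IsManifold (𝓡 n) ∞ X] (d : ℕ) :
    ContMDiffVectorBundle ∞ (FormModel n d) (FormBundle n d : X → Type _) (𝓡 n) :=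
  (Bundle.ContinuousAlternatingMap.vectorPrebundle ℝ (Fin d) (Coord n)
      (TangentSpace (𝓡 n) : X → Type _) ℝ (Bundle.Trivial X ℝ)).contMDiffVectorBundle (𝓡 n)

/-- The representative on `ℝⁿ` of a differential form in a chart, `(φ⁻¹)^* θ`. -/
def chartForm {d : ℕ} (φ : OpenPartialHomeomorph X (Coord n)) (θ : ∀ x : X, FormBundle n d x)
    (y : Coord n) : FormModel n d :=
  (θ (φ.symm y)).compContinuousLinearMap (mfderiv (𝓡 n) (𝓡 n) φ.symm y)

/-- The exterior derivative of a differential form on a manifold: `dθ = φ^* d((φ⁻¹)^* θ)`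
near `x`, with `φ` the preferred chart at `x`. -/
def extDer {d : ℕ} (θ : ∀ x : X, FormBundle n d x) (x : X) : FormBundle n (d + 1) x :=
  ContinuousAlternatingMap.compContinuousLinearMap
    (extDeriv (chartForm (chartAt (Coord n) x) θ) (chartAt (Coord n) x x))
    (mfderiv (𝓡 n) (𝓡 n) (chartAt (Coord n) x) x)

/-- The volume form `dy¹ ∧ ⋯ ∧ dyⁿ` of `ℝⁿ`. -/
def volForm (n : ℕ) : FormModel n n :=
  { (EuclideanSpace.basisFun (Fin n) ℝ).toBasis.det with
    cont := by
      have h : Continuous fun v : Fin n → Coord n =>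
          (Matrix.of fun i j : Fin n => v j i).det :=
        Continuous.matrix_det (continuous_matrix fun i j =>
          (EuclideanSpace.proj i : Coord n →L[ℝ] ℝ).continuous.comp (continuous_apply j))
      exact h }

lemma volForm_apply (v : Fin n → Coord n) :
    volForm n v = (Matrix.of fun i j : Fin n => v j i).det := rfl

/-- The coordinate volume form `dx = dx¹ ∧ ⋯ ∧ dxⁿ` of a chart. -/
def coordVol (φ : OpenPartialHomeomorph X (Coord n)) (x : X) : FormBundle n n x :=
  ContinuousAlternatingMap.compContinuousLinearMap (volForm n) (mfderiv (𝓡 n) (𝓡 n) φ x)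

/-- The contraction `∂ⱼ ⌟ dx` of the coordinate volume form with the coordinate vector field
`∂ⱼ`, that is, the pullback along the chart of `eⱼ ⌟ (dy¹ ∧ ⋯ ∧ dyⁿ)`. -/
def coordContr {m : ℕ} {X : Type*} [TopologicalSpace X] [ChartedSpace (Coord (m + 1)) X]
    (φ : OpenPartialHomeomorph X (Coord (m + 1))) (j : Fin (m + 1)) (x : X) :
    FormBundle (m + 1) m x :=
  ContinuousAlternatingMap.compContinuousLinearMap
    ((volForm (m + 1)).curryLeft (EuclideanSpace.single j 1))
    (mfderiv (𝓡 (m + 1)) (𝓡 (m + 1)) φ x)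

end Forms

/-! ### Differential operators, traction fields and the exterior jet -/

section Operators

variable {n : ℕ} {X : Type*} [TopologicalSpace X] [ChartedSpace (Coord n) X] [IsManifold (𝓡 n) ∞ X]
  [T2Space X]

/-- A map `D` from sections of `V` to sections of `V'` is a linear differential operator of order
at most `k`: it is the composition of the jet extension `jᵏ` with a smooth morphism of vector
bundles `Jᵏ V → V'`. -/
def IsDiffOp (k : ℕ) {G : Type*} [NormedAddCommGroup G] [NormedSpace ℝ G] [FiniteDimensional ℝ G]
    {V : X → Type*} [∀ x, AddCommGroup (V x)] [∀ x, Module ℝ (V x)]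
    [∀ x, TopologicalSpace (V x)] [TopologicalSpace (TotalSpace G V)]
    [FiberBundle G V] [VectorBundle ℝ G V] [ContMDiffVectorBundle ∞ G V (𝓡 n)]
    {G' : Type*} [NormedAddCommGroup G'] [NormedSpace ℝ G']
    {V' : X → Type*} [∀ x, AddCommGroup (V' x)] [∀ x, Module ℝ (V' x)]
    [∀ x, TopologicalSpace (V' x)] [∀ x, IsTopologicalAddGroup (V' x)]
    [∀ x, ContinuousSMul ℝ (V' x)] [TopologicalSpace (TotalSpace G' V')]
    [FiberBundle G' V'] [VectorBundle ℝ G' V']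
    (D : Sections n G V → Sections n G' V') : Prop :=
  ∃ Φ : Sections n (JetModel n k G →L[ℝ] G') (fun x => JetBundle n G V k x →L[ℝ] V' x),
    ∀ s x, D s x = Φ x (jet k s x)

end Operators

section ExteriorJet

variable (m : ℕ) {X : Type*} [TopologicalSpace X] [ChartedSpace (Coord (m + 1)) X]
  [IsManifold (𝓡 (m + 1)) ∞ X] [T2Space X]
  (F : Type*) [NormedAddCommGroup F] [NormedSpace ℝ F] [FiniteDimensional ℝ F]
  (W : X → Type*) [∀ x, AddCommGroup (W x)] [∀ x, Module ℝ (W x)]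
  [∀ x, TopologicalSpace (W x)] [TopologicalSpace (TotalSpace F W)]
  [FiberBundle F W] [VectorBundle ℝ F W] [ContMDiffVectorBundle ∞ F W (𝓡 (m + 1))]

/-- The smooth sections of `L(Jʳ W, ⋀ⁿ⁻¹ T*X)`, where `n = m + 1` is the dimension of `X`. -/
abbrev TractionField (r : ℕ) :=
  Sections (m + 1) (JetModel (m + 1) r F →L[ℝ] FormModel (m + 1) m)
    (fun x : X => JetBundle (m + 1) F W r x →L[ℝ] FormBundle (m + 1) m x)

/-- The smooth sections of `L(J¹(Jʳ W), ⋀ⁿ T*X)`, where `n = m + 1` is the dimension of `X`. -/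
abbrev StressField (r : ℕ) :=
  Sections (m + 1)
    (JetModel (m + 1) 1 (JetModel (m + 1) r F) →L[ℝ] FormModel (m + 1) (m + 1))
    (fun x : X => JetBundle (m + 1) (JetModel (m + 1) r F) (JetBundle (m + 1) F W r) 1 x →L[ℝ]
      FormBundle (m + 1) (m + 1) x)

variable {m F W}

/-- The defining relation `τ · j¹λ = d(σ · λ)` of the exterior jet `τ` of `σ`, for all smooth
sections `λ` of `Jʳ W`. -/
def IsExteriorJetOf {r : ℕ} (σ : TractionField m F W r) (τ : StressField m F W r) : Prop :=
  ∀ (lam : Sections (m + 1) (JetModel (m + 1) r F) (JetBundle (m + 1) F W r)) (x : X),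
    τ x (jet 1 lam x) = extDer (fun z => σ z (lam z)) x

end ExteriorJet

/-! ### Naturality -/

section Naturality

/-- The bundle-valued forms `σ` on `X` and `σ'` on `X'` correspond to each other under `φ` and the
relation `R` of the fibres: `σ` is the pullback of `σ'`. -/
def FormRel {n d : ℕ} {X : Type*} [TopologicalSpace X]
    [ChartedSpace (Coord n) X] {X' : Type*} [TopologicalSpace X'] [ChartedSpace (Coord n) X']
    (φ : X → X') {V : X → Type*} {V' : X' → Type*}
    (R : ∀ x, V x → V' (φ x) → Prop)
    (σ : ∀ x, V x → FormBundle n d x) (σ' : ∀ x, V' x → FormBundle n d x) : Prop :=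
  ∀ x p p', R x p p' → σ x p =
    ContinuousAlternatingMap.compContinuousLinearMap (σ' (φ x) p') (mfderiv (𝓡 n) (𝓡 n) φ x)

variable {n : ℕ} {X : Type*} [TopologicalSpace X] [ChartedSpace (Coord n) X] [IsManifold (𝓡 n) ∞ X]
  {F : Type*} [NormedAddCommGroup F] [NormedSpace ℝ F]
  {W : X → Type*} [∀ x, AddCommGroup (W x)] [∀ x, Module ℝ (W x)]
  [∀ x, TopologicalSpace (W x)] [TopologicalSpace (TotalSpace F W)]
  [FiberBundle F W] [VectorBundle ℝ F W] [ContMDiffVectorBundle ∞ F W (𝓡 n)]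
  {X' : Type*} [TopologicalSpace X'] [ChartedSpace (Coord n) X'] [IsManifold (𝓡 n) ∞ X']
  {F' : Type*} [NormedAddCommGroup F'] [NormedSpace ℝ F']
  {W' : X' → Type*} [∀ x, AddCommGroup (W' x)] [∀ x, Module ℝ (W' x)]
  [∀ x, TopologicalSpace (W' x)] [TopologicalSpace (TotalSpace F' W')]
  [FiberBundle F' W'] [VectorBundle ℝ F' W'] [ContMDiffVectorBundle ∞ F' W' (𝓡 n)]

/-- The prolongation to jets of a relation `R` between the fibres `W_z` and `W'_{φ z}`: the jets
`p` at `x` and `p'` at `φ x` are related when they are the jets of sections `w` and `w'` such that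
`w z` and `w' (φ z)` are related for all `z`. If `R` is the graph of a vector bundle map over a
local diffeomorphism `φ` that is an isomorphism on fibres, then this is the graph of the
induced map of jet bundles. -/
def JetRel (φ : X → X') (R : ∀ x, W x → W' (φ x) → Prop) (r : ℕ) (x : X)
    (p : JetBundle n F W r x) (p' : JetBundle n F' W' r (φ x)) : Prop :=
  ∃ (w : Sections n F W) (w' : Sections n F' W'), (∀ z, R z (w z) (w' (φ z))) ∧
    jetAt r x w = p ∧ jetAt r (φ x) w' = p'

end Naturality

/-! ### Local representatives -/

section Local

variable {n : ℕ} {X : Type*} [TopologicalSpace X] [ChartedSpace (Coord n) X] [IsManifold (𝓡 n) ∞ X]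
  {F : Type*} [NormedAddCommGroup F] [NormedSpace ℝ F]
  {W : X → Type*} [∀ x, AddCommGroup (W x)] [∀ x, Module ℝ (W x)]
  [∀ x, TopologicalSpace (W x)] [TopologicalSpace (TotalSpace F W)]
  [FiberBundle F W] [VectorBundle ℝ F W]
  {ν : ℕ} {s : Fin ν → ∀ x, W x} {φ : OpenPartialHomeomorph X (Coord n)}

/-- The component `w^α`, as a function of the coordinates, of a section `w` in a local frame
`s₁, …, s_ν` of `W` over the domain of a chart. -/
def frameRep (hs : IsLocalFrameOn (𝓡 n) F ∞ s φ.source) (α : Fin ν) (w : ∀ x, W x)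
    (y : Coord n) : ℝ :=
  hs.coeff α (φ.symm y) (w (φ.symm y))

variable [ContMDiffVectorBundle ∞ F W (𝓡 n)]

/-- The element `e^α_J` of the dual local frame of `Jʳ W`: the jet of a section `w` is sent to the
partial derivative `w^α_{,J}`. -/
def jetComp (hs : IsLocalFrameOn (𝓡 n) F ∞ s φ.source) {r : ℕ} (α : Fin ν) (J : MultiIndex n r)
    (x : X) (p : JetBundle n F W r x) : ℝ :=
  multiDeriv J.1 (frameRep hs α (jetRepr p)) (φ x)

set_option linter.unusedSectionVars false

lemma exists_frameRep_eq [FiniteDimensional ℝ F] (hφ : φ ∈ IsManifold.maximalAtlas (𝓡 n) ∞ X)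
    (hs : IsLocalFrameOn (𝓡 n) F ∞ s φ.source) (α : Fin ν) {x : X} (hx : x ∈ φ.source) :
    ∃ G : Coord n → F →L[ℝ] ℝ, ContDiffAt ℝ ∞ G (φ x) ∧ ∀ w : ∀ x, W x, frameRep hs α w
      =ᶠ[𝓝 (φ x)] fun y => G y (localRep φ (trivializationAt F W x) w y) := by
  set e := trivializationAt F W x with he
  have hxe : x ∈ e.baseSet := mem_baseSet_trivializationAt F W x
  have hcont : ContinuousAt φ.symm (φ x) := φ.symm.continuousAt (φ.map_source hx)
  have hinv : φ.symm (φ x) = x := φ.left_inv hx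
  -- the matrix of the frame
  let E : Coord n → (Fin ν → ℝ) →L[ℝ] F := fun y =>
    ∑ β, (ContinuousLinearMap.proj β : (Fin ν → ℝ) →L[ℝ] ℝ).smulRight
      (localRep φ e (s β) y)
  have hE : ContDiffAt ℝ ∞ E (φ x) := by
    refine ContDiffAt.sum fun β _ => ?_
    have h1 : ContDiffAt ℝ ∞ (localRep φ e (s β)) (φ x) := by
      rw [← contMDiffAt_iff_contDiffAt]
      have h1 : ContMDiffAt (𝓡 n) 𝓘(ℝ, F) ∞ (fun z => (e ⟨z, s β z⟩).2) (φ.symm (φ x)) := by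
        rw [hinv]
        exact (e.contMDiffAt_section_iff hxe).1
          ((hs.contMDiffOn β).contMDiffAt (φ.open_source.mem_nhds hx))
      exact h1.comp (φ x) (contMDiffAt_symm_of_mem_maximalAtlas hφ (φ.map_source hx))
    exact ((ContinuousLinearMap.smulRightL ℝ (Fin ν → ℝ) F
      (ContinuousLinearMap.proj β)).contDiff.contDiffAt).comp (φ x) h1
  have hEq : ∀ y, φ.symm y ∈ φ.source ∩ e.baseSet → ∃ L : (Fin ν → ℝ) ≃L[ℝ] F,
      (L : (Fin ν → ℝ) →L[ℝ] F) = E y ∧ ∀ w : ∀ x, W x,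
        L (fun β => frameRep hs β w y) = localRep φ e w y := by
    rintro y ⟨h1, h2⟩
    let b := hs.toBasisAt h1
    let L : (Fin ν → ℝ) ≃ₗ[ℝ] F := b.equivFun.symm.trans (e.continuousLinearEquivAt ℝ _ h2).toLinearEquiv
    have hL : ∀ v, L v = E y v := by
      intro v
      have h3 : L v = e.continuousLinearEquivAt ℝ _ h2 (∑ β, v β • s β (φ.symm y)) := by
        simp [L, b, Module.Basis.equivFun_symm_apply]
      rw [h3, map_sum]
      simp only [E, localRep, map_smul, sum_apply, ContinuousLinearMap.smulRight_apply,
        ContinuousLinearMap.proj_apply]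
      rfl
    refine ⟨L.toContinuousLinearEquiv, ?_, fun w => ?_⟩
    · ext1 v
      exact hL v
    · have h4 := hs.coeff_sum_eq w h1
      change L (fun β => frameRep hs β w y) = _
      have h3 : L (fun β => frameRep hs β w y) =
          e.continuousLinearEquivAt ℝ _ h2 (∑ β, frameRep hs β w y • s β (φ.symm y)) := by
        simp [L, b, Module.Basis.equivFun_symm_apply]
      rw [h3]
      have h5 : ∑ β, frameRep hs β w y • s β (φ.symm y) = w (φ.symm y) := h4.symm
      rw [h5]
      rfl
  refine ⟨fun y => (ContinuousLinearMap.proj α : (Fin ν → ℝ) →L[ℝ] ℝ).comp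
    (ContinuousLinearMap.inverse (E y)), ?_, fun w => ?_⟩
  · obtain ⟨L, hL, -⟩ := hEq (φ x) (by rw [hinv]; exact ⟨hx, hxe⟩)
    have h1 : ContDiffAt ℝ ∞ ContinuousLinearMap.inverse (E (φ x)) := by
      rw [← hL]; exact contDiffAt_map_inverse L
    exact contDiffAt_const.clm_comp (h1.comp (φ x) hE)
  · have hU : φ.source ∩ e.baseSet ∈ 𝓝 (φ.symm (φ x)) := by
      rw [hinv]
      exact (φ.open_source.inter e.open_baseSet).mem_nhds ⟨hx, hxe⟩
    filter_upwards [hcont hU] with y hy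
    obtain ⟨L, hL, hL'⟩ := hEq y hy
    rw [← hL' w, ← hL, ContinuousLinearMap.comp_apply, ContinuousLinearMap.inverse_equiv]
    simp

/-- The components of the jet of `w` are the partial derivatives of the components of `w`. -/
lemma jetComp_jetAt [FiniteDimensional ℝ F] (hφ : φ ∈ IsManifold.maximalAtlas (𝓡 n) ∞ X)
    (hs : IsLocalFrameOn (𝓡 n) F ∞ s φ.source) {r : ℕ} (α : Fin ν) (J : MultiIndex n r)
    {x : X} (hx : x ∈ φ.source) (w : Sections n F W) :
    jetComp hs α J x (jetAt r x w) = multiDeriv J.1 (frameRep hs α w) (φ x) := by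
  obtain ⟨G, hG, hGw⟩ := exists_frameRep_eq hφ hs α hx
  have hxe : x ∈ (trivializationAt F W x).baseSet := mem_baseSet_trivializationAt F W x
  have hsm : ∀ w : Sections n F W, ContDiffAt ℝ ∞ (frameRep hs α w) (φ x) := fun w =>
    (hG.clm_apply (contDiffAt_localRep hφ _ w hx hxe)).congr_of_eventuallyEq (hGw w)
  set t := jetRepr (jetAt r x w) with ht
  have h1 : jetAt r x (t + (-1 : ℝ) • w) = 0 := by
    rw [map_add, map_smul, ht, jetAt_jetRepr]; simp
  have h2 : Flat r (localRep φ (trivializationAt F W x) (t + (-1 : ℝ) • w : Sections n F W))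
      (φ x) := flat_of_sorted (contDiffAt_localRep hφ _ _ hx hxe)
    ((jetAt_eq_zero_iff hφ _ _ hx hxe).1 h1)
  have h3 := (Flat.transform (ψ := id) (contDiffAt_localRep hφ _ _ hx hxe) contDiffAt_id hG
    h2).congr (hGw (t + (-1 : ℝ) • w : Sections n F W)).symm
  have h4 : frameRep hs α (t + (-1 : ℝ) • w : Sections n F W) =
      frameRep hs α t + (-1 : ℝ) • frameRep hs α w := by
    ext y
    change hs.coeff α _ (t _ + (-1 : ℝ) • w _) = _
    rw [map_add, map_smul]
    rfl
  have h5 : multiDeriv J.1 (frameRep hs α t + (-1 : ℝ) • frameRep hs α w) (φ x) = 0 := by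
    rw [← h4]; exact h3 J.1 J.2.2
  have h6 : ContDiffAt ℝ ∞ ((-1 : ℝ) • frameRep hs α w) (φ x) := (hsm w).const_smul (-1 : ℝ)
  rw [(multiDeriv_add (hsm t) h6 J.1).eq_of_nhds, Pi.add_apply,
    (multiDeriv_smul (-1) (hsm w) J.1).eq_of_nhds] at h5
  change multiDeriv J.1 (frameRep hs α t) (φ x) = _
  simpa [add_neg_eq_zero] using h5

end Local

section LocalRepresentatives

variable {m : ℕ} {X : Type*} [TopologicalSpace X] [ChartedSpace (Coord (m + 1)) X]
  [IsManifold (𝓡 (m + 1)) ∞ X] [T2Space X]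
  {F : Type*} [NormedAddCommGroup F] [NormedSpace ℝ F] [FiniteDimensional ℝ F]
  {W : X → Type*} [∀ x, AddCommGroup (W x)] [∀ x, Module ℝ (W x)]
  [∀ x, TopologicalSpace (W x)] [TopologicalSpace (TotalSpace F W)]
  [FiberBundle F W] [VectorBundle ℝ F W] [ContMDiffVectorBundle ∞ F W (𝓡 (m + 1))]
  {ν : ℕ} {s : Fin ν → ∀ x, W x} {φ : OpenPartialHomeomorph X (Coord (m + 1))}

/-- `σ = σ^{Jj}_α e^α_J ⊗ (∂ⱼ ⌟ dx)` over the domain of the chart `φ`, with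
`σ^{Jj}_α = c α J j`. -/
def TractionField.HasComponents (hs : IsLocalFrameOn (𝓡 (m + 1)) F ∞ s φ.source) {r : ℕ}
    (σ : TractionField m F W r) (c : Fin ν → MultiIndex (m + 1) r → Fin (m + 1) → X → ℝ) : Prop :=
  ∀ x ∈ φ.source, ∀ p : JetBundle (m + 1) F W r x,
    σ x p = ∑ α, ∑ J, ∑ j, (c α J j x * jetComp hs α J x p) • coordContr φ j x

/-- `τ = (a^J_α e^α_J + b^{Jj}_α e^α_J ⊗ ∂ⱼ) ⊗ dx` over the domain of the chart `φ`. On the `1`-jet of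
a section `λ = (λ^α_J)` of `Jʳ W`, the functional `e^α_J` is `λ^α_J` and the functional
`e^α_J ⊗ ∂ⱼ` is the partial derivative `λ^α_{J,j}`. -/
def StressField.HasComponents (hs : IsLocalFrameOn (𝓡 (m + 1)) F ∞ s φ.source) {r : ℕ}
    (τ : StressField m F W r) (a : Fin ν → MultiIndex (m + 1) r → X → ℝ)
    (b : Fin ν → MultiIndex (m + 1) r → Fin (m + 1) → X → ℝ) : Prop :=
  ∀ x ∈ φ.source, ∀ lam : Sections (m + 1) (JetModel (m + 1) r F) (JetBundle (m + 1) F W r),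
    τ x (jet 1 lam x) = (∑ α, ∑ J, (a α J x * jetComp hs α J x (lam x) +
      ∑ j, b α J j x * pderiv j (fun y => jetComp hs α J (φ.symm y) (lam (φ.symm y))) (φ x))) •
        coordVol φ x

end LocalRepresentatives

end HyperStress

end

open HyperStress

/-! Write `n = m + 1` and `r = k - 1`. In a chart and local trivializations, `σ · λ` is the
representative of `σ` evaluated on that of `λ`. By the Leibniz rule its first derivative at a point
is a sum of two terms, bilinear in the 1-jets of `σ` and `λ` there. The exterior derivative sees
only this first derivative, so `d(σ · λ)` vanishes at `x` as soon as `j¹λ` or `j¹σ` vanishes at `x`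
(`fderiv_localRep_applySection`, `extDerSection_eq_zero`).

The invariant statements follow from this and one general fact, `exists_jet_factorization`: a linear
operator on sections whose value at each point vanishes together with the `k`-jet there factors
through a smooth morphism from the `k`-jet bundle. Applied to `λ ↦ d(σ · λ)` it produces `𝔡σ`;
applied to `σ ↦ 𝔡σ` it shows that `𝔡` has order one. The pointwise factorization is immediate, since
a jet fibre is a quotient of the space of global sections. For the same reason `𝔡σ` is unique, and
uniqueness makes `𝔡` linear.

The content of the factorization is smoothness, which rests on `contMDiffAt_of_comp_eq`: if `C ∘ M =
L` near `x` with `M`, `L` smooth and `M x = 1`, then `C = L ∘ M⁻¹` is smooth at `x`. A linear family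
of sections with prescribed jets at `x` supplies `M` and `L`.

Naturality is that of `d`: if `λ` and `λ'` are related, then `σ · λ` is the pullback of `σ' · λ'`.
Independence of `d` from the chart is the case of the identity map; both cases come from
`extDeriv_chartForm_pullback`.

For the local formula, the forms `eⱼ ⌟ dy` are a basis of the `(n - 1)`-forms with coefficient
functionals `contrCoeff`, in which `d` is the divergence (`extDeriv_eq_sum_pderiv`). It remains to
differentiate the products `σ^{Jj}_α λ^α_J`, once both factors are known to be smooth
(`TractionField.HasComponents.contMDiffOn`, `contMDiffAt_jetComp`). -/

noncomputable section

namespace HyperStress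

/-! ### Pullback of forms and the exterior derivative on a manifold -/

section FormPullback

set_option linter.unusedSectionVars false

variable {n d : ℕ} {X : Type*} [TopologicalSpace X] [ChartedSpace (Coord n) X]
  {X' : Type*} [TopologicalSpace X'] [ChartedSpace (Coord n) X']

/-- The pullback `g^* θ` of a form on a manifold along a map `g` from `ℝⁿ`. -/
def formPull (θ : ∀ x : X, FormBundle n d x) (g : Coord n → X) (y : Coord n) : FormModel n d :=
  (θ (g y)).compContinuousLinearMap (mfderiv (𝓡 n) (𝓡 n) g y)

lemma formPull_congr (θ : ∀ x : X, FormBundle n d x) {g g' : Coord n → X} {y : Coord n}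
    (h : g =ᶠ[𝓝 y] g') : formPull θ g y = formPull θ g' y := by
  -- The two values of `θ` lie in different fibres, so the base points have to become variables
  -- before they can be identified.
  have key : ∀ (a b : X) (_ : a = b) (A B : Coord n →L[ℝ] Coord n) (_ : A = B),
      ((θ a).compContinuousLinearMap A : FormModel n d) =
        ((θ b).compContinuousLinearMap B : FormModel n d) := by
    rintro a _ rfl A _ rfl
    rfl
  exact key _ _ h.eq_of_nhds _ _ h.mfderiv_eq

lemma formPull_comp (θ' : ∀ x : X', FormBundle n d x) {f : X → X'} {g : Coord n → X} {y : Coord n}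
    (hf : MDifferentiableAt (𝓡 n) (𝓡 n) f (g y)) (hg : MDifferentiableAt (𝓡 n) (𝓡 n) g y) :
    formPull θ' (f ∘ g) y = ContinuousAlternatingMap.compContinuousLinearMap
      (ContinuousAlternatingMap.compContinuousLinearMap (θ' (f (g y)))
        (mfderiv (𝓡 n) (𝓡 n) f (g y))) (mfderiv (𝓡 n) (𝓡 n) g y) := by
  unfold formPull
  rw [mfderiv_comp y hf hg]
  rfl

lemma formPull_comp_coord (θ : ∀ x : X, FormBundle n d x) {g : Coord n → X} {ψ : Coord n → Coord n}
    {y : Coord n} (hg : MDifferentiableAt (𝓡 n) (𝓡 n) g (ψ y)) (hψ : DifferentiableAt ℝ ψ y) :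
    formPull θ (g ∘ ψ) y = (formPull θ g (ψ y)).compContinuousLinearMap (fderiv ℝ ψ y) := by
  unfold formPull
  rw [mfderiv_comp y hg hψ.mdifferentiableAt, mfderiv_eq_fderiv]
  rfl

lemma mdifferentiableAt_of_mem_maximalAtlas {φ : OpenPartialHomeomorph X (Coord n)}
    (hφ : φ ∈ IsManifold.maximalAtlas (𝓡 n) ∞ X) {x : X} (hx : x ∈ φ.source) :
    MDifferentiableAt (𝓡 n) (𝓡 n) φ x :=
  (contMDiffAt_of_mem_maximalAtlas hφ hx).mdifferentiableAt (by simp)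

lemma mdifferentiableAt_symm_of_mem_maximalAtlas {φ : OpenPartialHomeomorph X (Coord n)}
    (hφ : φ ∈ IsManifold.maximalAtlas (𝓡 n) ∞ X) {y : Coord n} (hy : y ∈ φ.target) :
    MDifferentiableAt (𝓡 n) (𝓡 n) φ.symm y :=
  (contMDiffAt_symm_of_mem_maximalAtlas hφ hy).mdifferentiableAt (by simp)

/-- The representative of `f^* θ'` in a chart is the pullback of the representative of `θ'` along
the representative of `f`. -/
lemma chartForm_pullback {φ : OpenPartialHomeomorph X (Coord n)}
    (hφ : φ ∈ IsManifold.maximalAtlas (𝓡 n) ∞ X) {φ' : OpenPartialHomeomorph X' (Coord n)}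
    (hφ' : φ' ∈ IsManifold.maximalAtlas (𝓡 n) ∞ X') {f : X → X'} (hf : ContMDiff (𝓡 n) (𝓡 n) ∞ f)
    {θ : ∀ x : X, FormBundle n d x} {θ' : ∀ x : X', FormBundle n d x}
    (h : ∀ x, θ x = ContinuousAlternatingMap.compContinuousLinearMap (θ' (f x))
      (mfderiv (𝓡 n) (𝓡 n) f x)) {y : Coord n} (hy : y ∈ φ.target)
    (hy' : f (φ.symm y) ∈ φ'.source) :
    chartForm φ θ y = (chartForm φ' θ' (φ' (f (φ.symm y)))).compContinuousLinearMap
      (fderiv ℝ (fun z => φ' (f (φ.symm z))) y) := by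
  have hs := mdifferentiableAt_symm_of_mem_maximalAtlas hφ hy
  have hfy : MDifferentiableAt (𝓡 n) (𝓡 n) f (φ.symm y) :=
    hf.contMDiffAt.mdifferentiableAt (by simp)
  have hψ : DifferentiableAt ℝ (fun z => φ' (f (φ.symm z))) y := by
    rw [← mdifferentiableAt_iff_differentiableAt]
    exact (mdifferentiableAt_of_mem_maximalAtlas hφ' hy').comp y (hfy.comp y hs)
  have h1 : chartForm φ θ y = formPull θ' (f ∘ φ.symm) y := by
    rw [formPull_comp θ' hfy hs, ← h]
    rfl
  -- Near `y` the map `f ∘ φ.symm` factors through the chart `φ'`, so the pullback along it can be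
  -- split into the chart form of `θ'` and the coordinate map.
  have h2 : f ∘ φ.symm =ᶠ[𝓝 y] φ'.symm ∘ fun z => φ' (f (φ.symm z)) := by
    have hc : ContinuousAt (f ∘ φ.symm) y := hfy.continuousAt.comp hs.continuousAt
    filter_upwards [hc (φ'.open_source.mem_nhds hy')] with z hz
    exact (φ'.left_inv hz).symm
  rw [h1, formPull_congr θ' h2, formPull_comp_coord θ' _ hψ]
  · rfl
  · exact mdifferentiableAt_symm_of_mem_maximalAtlas hφ' (φ'.map_source hy')

lemma contDiffAt_chart_rep {φ : OpenPartialHomeomorph X (Coord n)}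
    (hφ : φ ∈ IsManifold.maximalAtlas (𝓡 n) ∞ X) {φ' : OpenPartialHomeomorph X' (Coord n)}
    (hφ' : φ' ∈ IsManifold.maximalAtlas (𝓡 n) ∞ X') {f : X → X'} (hf : ContMDiff (𝓡 n) (𝓡 n) ∞ f)
    {y : Coord n} (hy : y ∈ φ.target) (hy' : f (φ.symm y) ∈ φ'.source) :
    ContDiffAt ℝ ∞ (fun z => φ' (f (φ.symm z))) y := by
  rw [← contMDiffAt_iff_contDiffAt]
  exact (contMDiffAt_of_mem_maximalAtlas hφ' hy').comp y
    (hf.contMDiffAt.comp y (contMDiffAt_symm_of_mem_maximalAtlas hφ hy))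

lemma eventually_mem_chart_rep {φ : OpenPartialHomeomorph X (Coord n)}
    {φ' : OpenPartialHomeomorph X' (Coord n)} {f : X → X'} (hf : Continuous f)
    {y : Coord n} (hy : y ∈ φ.target) (hy' : f (φ.symm y) ∈ φ'.source) :
    ∀ᶠ z in 𝓝 y, z ∈ φ.target ∧ f (φ.symm z) ∈ φ'.source := by
  have hc : ContinuousAt (fun z => f (φ.symm z)) y :=
    hf.continuousAt.comp (φ.symm.continuousAt hy)
  filter_upwards [φ.open_target.mem_nhds hy, hc (φ'.open_source.mem_nhds hy')] with z h1 h2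
  exact ⟨h1, h2⟩

/-- Naturality of `d` on `ℝⁿ`, applied to the coordinate expression `ψ` of `f`, together with the
chain rule for `ψ ∘ φ = φ' ∘ f`. With `f = id` this gives independence of the chart, and with
preferred charts it gives naturality on manifolds. -/
lemma extDeriv_chartForm_pullback {φ : OpenPartialHomeomorph X (Coord n)}
    (hφ : φ ∈ IsManifold.maximalAtlas (𝓡 n) ∞ X) {φ' : OpenPartialHomeomorph X' (Coord n)}
    (hφ' : φ' ∈ IsManifold.maximalAtlas (𝓡 n) ∞ X') {f : X → X'} (hf : ContMDiff (𝓡 n) (𝓡 n) ∞ f)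
    {θ : ∀ x : X, FormBundle n d x} {θ' : ∀ x : X', FormBundle n d x}
    (h : ∀ x, θ x = ContinuousAlternatingMap.compContinuousLinearMap (θ' (f x))
      (mfderiv (𝓡 n) (𝓡 n) f x)) {x : X} (hx : x ∈ φ.source) (hx' : f x ∈ φ'.source)
    (hθ' : DifferentiableAt ℝ (chartForm φ' θ') (φ' (f x))) :
    ((extDeriv (chartForm φ θ) (φ x)).compContinuousLinearMap
        (mfderiv (𝓡 n) (𝓡 n) φ x : Coord n →L[ℝ] Coord n) : FormModel n (d + 1)) =
      ((extDeriv (chartForm φ' θ') (φ' (f x))).compContinuousLinearMap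
        (mfderiv (𝓡 n) (𝓡 n) φ' (f x) : Coord n →L[ℝ] Coord n)).compContinuousLinearMap
          (mfderiv (𝓡 n) (𝓡 n) f x : Coord n →L[ℝ] Coord n) := by
  have hinv := φ.left_inv hx
  have hy := φ.map_source hx
  have hy' : f (φ.symm (φ x)) ∈ φ'.source := by rwa [hinv]
  have hψ := contDiffAt_chart_rep hφ hφ' hf hy hy'
  set ψ : Coord n → Coord n := fun z => φ' (f (φ.symm z)) with hψdef
  have hψx : ψ (φ x) = φ' (f x) := by simp only [hψdef, hinv]
  have hev : chartForm φ θ =ᶠ[𝓝 (φ x)]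
      fun z => (chartForm φ' θ' (ψ z)).compContinuousLinearMap (fderiv ℝ ψ z) := by
    filter_upwards [eventually_mem_chart_rep hf.continuous hy hy'] with z hz
    exact chartForm_pullback hφ hφ' hf h hz.1 hz.2
  rw [hev.extDeriv_eq, extDeriv_pullback (by rwa [hψx]) hψ (by simpa using two_le_infty), hψx]
  have hfx : MDifferentiableAt (𝓡 n) (𝓡 n) f x := hf.contMDiffAt.mdifferentiableAt (by simp)
  have hφx := mdifferentiableAt_of_mem_maximalAtlas hφ hx
  have h1 : ψ ∘ φ =ᶠ[𝓝 x] φ' ∘ f := by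
    filter_upwards [φ.open_source.mem_nhds hx] with z hz
    simp only [hψdef, Function.comp, φ.left_inv hz]
  have h2 : (fderiv ℝ ψ (φ x)).comp (mfderiv (𝓡 n) (𝓡 n) φ x : Coord n →L[ℝ] Coord n) =
      (mfderiv (𝓡 n) (𝓡 n) φ' (f x) : Coord n →L[ℝ] Coord n).comp
        (mfderiv (𝓡 n) (𝓡 n) f x : Coord n →L[ℝ] Coord n) := by
    have h3 := mfderiv_comp x (hψ.differentiableAt (by simp)).mdifferentiableAt hφx
    have h4 := mfderiv_comp x (mdifferentiableAt_of_mem_maximalAtlas hφ' hx') hfx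
    rw [mfderiv_eq_fderiv] at h3
    exact h3.symm.trans (h1.mfderiv_eq.trans h4)
  change (extDeriv (chartForm φ' θ') (φ' (f x))).compContinuousLinearMap
    ((fderiv ℝ ψ (φ x)).comp (mfderiv (𝓡 n) (𝓡 n) φ x : Coord n →L[ℝ] Coord n)) = _
  rw [h2]
  rfl

variable [IsManifold (𝓡 n) ∞ X] [IsManifold (𝓡 n) ∞ X']

/-- The tangent trivialization centred at `x` is inverse to the derivative of the inverse chart, and
the trivial target contributes the identity. This is the bridge between smoothness of a section of
the form bundle and smoothness of its representative on `ℝⁿ`. -/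
lemma chartForm_chartAt_eq_localRep (θ : ∀ x : X, FormBundle n d x) (x : X) {y : Coord n}
    (hy : y ∈ (chartAt (Coord n) x).target) :
    chartForm (chartAt (Coord n) x) θ y = localRep (chartAt (Coord n) x)
      (trivializationAt (FormModel n d) (FormBundle n d : X → Type _) x) θ y := by
  set c := chartAt (Coord n) x with hc
  have h1 := TangentBundle.symmL_trivializationAt (I := 𝓡 n) (x₀ := x) (c.map_target hy)
  have h3 : (extChartAt (𝓡 n) x) (c.symm y) = y := by
    simpa using c.right_inv hy
  rw [h3, ModelWithCorners.range_eq_univ, mfderivWithin_univ] at h1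
  have h4 : mfderiv 𝓘(ℝ, Coord n) (𝓡 n) (extChartAt (𝓡 n) x).symm y =
      mfderiv (𝓡 n) (𝓡 n) c.symm y := by
    simp [extChartAt, OpenPartialHomeomorph.extend]
    rfl
  have h5 : (trivializationAt ℝ (Bundle.Trivial X ℝ) x).continuousLinearMapAt ℝ (c.symm y) =
      ContinuousLinearMap.id ℝ ℝ := Bundle.Trivial.continuousLinearMapAt_trivialization ℝ X ℝ _
  rw [localRep, FiberBundle.trivializationAt_continuousAlternatingMap_apply]
  simp only [ContinuousAlternatingMap.inCoordinates]
  rw [h1]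
  ext v
  rw [h4, h5]
  rfl

lemma id_pullback (θ : ∀ x : X, FormBundle n d x) (x : X) :
    θ x = ContinuousAlternatingMap.compContinuousLinearMap (θ (id x))
      (mfderiv (𝓡 n) (𝓡 n) (id : X → X) x) := by
  rw [mfderiv_id]
  rfl

/-- The representative of a smooth form in a chart is smooth. -/
lemma contDiffAt_chartForm {φ : OpenPartialHomeomorph X (Coord n)}
    (hφ : φ ∈ IsManifold.maximalAtlas (𝓡 n) ∞ X)
    (θ : Sections n (FormModel n d) (FormBundle n d : X → Type _)) {x : X} (hx : x ∈ φ.source) :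
    ContDiffAt ℝ ∞ (chartForm φ θ) (φ x) := by
  set c := chartAt (Coord n) x with hc
  have hinv := φ.left_inv hx
  have hxc : φ.symm (φ x) ∈ c.source := by rw [hinv]; exact mem_chart_source _ x
  have hψ := contDiffAt_chart_rep hφ (chart_mem x) contMDiff_id (φ.map_source hx) hxc
  -- In the preferred chart at `x` smoothness is that of the bundle section; the representative in
  -- `φ` is then obtained by pulling back along the transition map.
  have h1 : ContDiffAt ℝ ∞ (chartForm c θ) (c x) := by
    refine (contDiffAt_localRep (chart_mem x) _ θ (mem_chart_source _ x)
      (mem_baseSet_trivializationAt _ _ x)).congr_of_eventuallyEq ?_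
    filter_upwards [c.open_target.mem_nhds (mem_chart_target _ x)] with y hy
    exact chartForm_chartAt_eq_localRep θ x hy
  have h2 : ContDiffAt ℝ ∞ (fun y => chartForm c θ (c (id (φ.symm y)))) (φ x) := by
    have h1' : ContDiffAt ℝ ∞ (chartForm c θ) (c (id (φ.symm (φ x)))) := by
      rw [hinv]
      exact h1
    exact h1'.comp (φ x) hψ
  have h3 : ContDiffAt ℝ ∞ (fun y => (ContinuousAlternatingMap.compContinuousLinearMapCLM
      (fderiv ℝ (fun z => c (id (φ.symm z))) y) : FormModel n d →L[ℝ] FormModel n d) (chartForm c θ (c (id (φ.symm y))))) (φ x) :=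
    (ContDiffAt.comp (φ x) (f := fderiv ℝ fun z => c (id (φ.symm z)))
      (contDiff_pullbackForm n d).contDiffAt (hψ.fderiv_right (m := ∞) (by simp))).clm_apply
      h2
  refine h3.congr_of_eventuallyEq ?_
  filter_upwards [eventually_mem_chart_rep continuous_id (φ.map_source hx) hxc] with y hy
  exact chartForm_pullback hφ (chart_mem x) contMDiff_id (id_pullback θ) hy.1 hy.2

lemma differentiableAt_chartForm {φ : OpenPartialHomeomorph X (Coord n)}
    (hφ : φ ∈ IsManifold.maximalAtlas (𝓡 n) ∞ X)
    (θ : Sections n (FormModel n d) (FormBundle n d : X → Type _)) {x : X} (hx : x ∈ φ.source) :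
    DifferentiableAt ℝ (chartForm φ θ) (φ x) :=
  (contDiffAt_chartForm hφ θ hx).differentiableAt (by simp)

/-- The exterior derivative can be computed in any chart. -/
lemma extDer_eq_of_mem_maximalAtlas {φ : OpenPartialHomeomorph X (Coord n)}
    (hφ : φ ∈ IsManifold.maximalAtlas (𝓡 n) ∞ X)
    (θ : Sections n (FormModel n d) (FormBundle n d : X → Type _)) {x : X} (hx : x ∈ φ.source) :
    extDer (fun z => θ z) x = ContinuousAlternatingMap.compContinuousLinearMap
      (extDeriv (chartForm φ θ) (φ x)) (mfderiv (𝓡 n) (𝓡 n) φ x) := by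
  have h := extDeriv_chartForm_pullback (chart_mem x) hφ contMDiff_id (id_pullback θ)
    (mem_chart_source _ x) hx (differentiableAt_chartForm hφ θ hx)
  rw [mfderiv_id] at h
  exact h

/-- The exterior derivative commutes with pullbacks. -/
lemma extDer_pullback {f : X → X'} (hf : ContMDiff (𝓡 n) (𝓡 n) ∞ f)
    {θ : ∀ x : X, FormBundle n d x}
    (θ' : Sections n (FormModel n d) (FormBundle n d : X' → Type _))
    (h : ∀ x, θ x = ContinuousAlternatingMap.compContinuousLinearMap (θ' (f x))
      (mfderiv (𝓡 n) (𝓡 n) f x)) (x : X) :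
    extDer θ x = ContinuousAlternatingMap.compContinuousLinearMap (extDer (fun z => θ' z) (f x))
      (mfderiv (𝓡 n) (𝓡 n) f x) :=
  extDeriv_chartForm_pullback (chart_mem x) (chart_mem (f x)) hf h
    (mem_chart_source _ x) (mem_chart_source _ (f x))
    (differentiableAt_chartForm (chart_mem (f x)) θ' (mem_chart_source _ (f x)))

lemma mfderiv_comp_mfderiv_symm {φ : OpenPartialHomeomorph X (Coord n)}
    (hφ : φ ∈ IsManifold.maximalAtlas (𝓡 n) ∞ X) {y : Coord n} (hy : y ∈ φ.target) :
    (mfderiv (𝓡 n) (𝓡 n) φ (φ.symm y) : Coord n →L[ℝ] Coord n).comp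
      (mfderiv (𝓡 n) (𝓡 n) φ.symm y : Coord n →L[ℝ] Coord n) = ContinuousLinearMap.id ℝ _ := by
  have h1 := mfderiv_comp y (mdifferentiableAt_of_mem_maximalAtlas hφ (φ.map_target hy))
    (mdifferentiableAt_symm_of_mem_maximalAtlas hφ hy)
  have h2 : φ ∘ φ.symm =ᶠ[𝓝 y] id := by
    filter_upwards [φ.open_target.mem_nhds hy] with z hz
    exact φ.right_inv hz
  have h3 := h2.mfderiv_eq (I := 𝓡 n) (I' := 𝓡 n)
  rw [mfderiv_id] at h3
  exact h1.symm.trans h3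

lemma mfderiv_symm_comp_mfderiv {φ : OpenPartialHomeomorph X (Coord n)}
    (hφ : φ ∈ IsManifold.maximalAtlas (𝓡 n) ∞ X) {x : X} (hx : x ∈ φ.source) :
    (mfderiv (𝓡 n) (𝓡 n) φ.symm (φ x) : Coord n →L[ℝ] Coord n).comp
      (mfderiv (𝓡 n) (𝓡 n) φ x : Coord n →L[ℝ] Coord n) = ContinuousLinearMap.id ℝ _ := by
  have h1 := mfderiv_comp x (mdifferentiableAt_symm_of_mem_maximalAtlas hφ (φ.map_source hx))
    (mdifferentiableAt_of_mem_maximalAtlas hφ hx)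
  have h2 : φ.symm ∘ φ =ᶠ[𝓝 x] id := by
    filter_upwards [φ.open_source.mem_nhds hx] with z hz
    exact φ.left_inv hz
  have h3 := h2.mfderiv_eq (I := 𝓡 n) (I' := 𝓡 n)
  rw [mfderiv_id] at h3
  exact h1.symm.trans h3

/-- `extDer` at a point uses the preferred chart of that very point, so its representative in a
fixed chart is accessible only through chart independence; the two derivatives of `φ` and its
inverse then cancel. -/
lemma chartForm_extDer {φ : OpenPartialHomeomorph X (Coord n)}
    (hφ : φ ∈ IsManifold.maximalAtlas (𝓡 n) ∞ X)
    (θ : Sections n (FormModel n d) (FormBundle n d : X → Type _)) {y : Coord n}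
    (hy : y ∈ φ.target) :
    chartForm φ (extDer fun z => θ z) y = extDeriv (chartForm φ θ) y := by
  rw [chartForm, extDer_eq_of_mem_maximalAtlas hφ θ (φ.map_target hy), φ.right_inv hy]
  change (extDeriv (chartForm φ θ) y).compContinuousLinearMap
    ((mfderiv (𝓡 n) (𝓡 n) φ (φ.symm y) : Coord n →L[ℝ] Coord n).comp
      (mfderiv (𝓡 n) (𝓡 n) φ.symm y : Coord n →L[ℝ] Coord n)) = _
  rw [mfderiv_comp_mfderiv_symm hφ hy]
  rfl

lemma contDiffAt_extDeriv {η : Coord n → FormModel n d} {y : Coord n} (h : ContDiffAt ℝ ∞ η y) :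
    ContDiffAt ℝ ∞ (extDeriv η) y := by
  have h1 := (h.fderiv_right (m := ∞) (by simp)).continuousLinearMap_comp
    (ContinuousAlternatingMap.alternatizeUncurryFinCLM ℝ (Coord n) ℝ (n := d))
  exact h1

/-- The exterior derivative as a linear map between spaces of smooth forms. -/
def extDerSection : Sections n (FormModel n d) (FormBundle n d : X → Type _) →ₗ[ℝ]
    Sections n (FormModel n (d + 1)) (FormBundle n (d + 1) : X → Type _) where
  toFun θ :=
    { toFun := extDer fun z => θ z
      contMDiff_toFun := fun x => by
        rw [Bundle.contMDiffAt_section]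
        -- In the trivialization centred at `x`, the section `extDer θ` reads `extDeriv` of the
        -- representative of `θ` in the one chart at `x`, although the definition changes chart from
        -- point to point.
        have h1 := (contDiffAt_extDeriv (contDiffAt_chartForm (chart_mem x) θ
          (mem_chart_source _ x))).contMDiffAt.comp x
            (contMDiffAt_of_mem_maximalAtlas (chart_mem x) (mem_chart_source _ x))
        refine h1.congr_of_eventuallyEq ?_
        filter_upwards [(chartAt (Coord n) x).open_source.mem_nhds (mem_chart_source _ x)] with z hz
        have hz' := (chartAt (Coord n) x).map_source hz
        rw [Function.comp, ← chartForm_extDer (chart_mem x) θ hz',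
          chartForm_chartAt_eq_localRep _ x hz', localRep, (chartAt (Coord n) x).left_inv hz] }
  map_add' θ θ' := by
    ext1 x
    have h1 : chartForm (chartAt (Coord n) x) (θ + θ' : Sections n (FormModel n d) _) =
        chartForm (chartAt (Coord n) x) θ + chartForm (chartAt (Coord n) x) θ' := rfl
    have h2 := extDeriv_add
      (differentiableAt_chartForm (chart_mem x) θ (mem_chart_source _ x))
      (differentiableAt_chartForm (chart_mem x) θ' (mem_chart_source _ x))
    rw [← h1] at h2
    exact congrArg (fun η : FormModel n (d + 1) => η.compContinuousLinearMap
      (mfderiv (𝓡 n) (𝓡 n) (chartAt (Coord n) x) x : Coord n →L[ℝ] Coord n)) h2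
  map_smul' a θ := by
    ext1 x
    have h1 : chartForm (chartAt (Coord n) x) (a • θ : Sections n (FormModel n d) _) =
        a • chartForm (chartAt (Coord n) x) θ := rfl
    have h2 := extDeriv_smul (x := chartAt (Coord n) x x) a (chartForm (chartAt (Coord n) x) θ)
    rw [← h1] at h2
    exact congrArg (fun η : FormModel n (d + 1) => η.compContinuousLinearMap
      (mfderiv (𝓡 n) (𝓡 n) (chartAt (Coord n) x) x : Coord n →L[ℝ] Coord n)) h2

/-- The exterior derivative of a form vanishes where the derivative of its chart
representative does. -/
lemma extDerSection_eq_zero (θ : Sections n (FormModel n d) (FormBundle n d : X → Type _)) (x : X)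
    (h : fderiv ℝ (localRep (chartAt (Coord n) x)
      (trivializationAt (FormModel n d) (FormBundle n d : X → Type _) x) θ)
        (chartAt (Coord n) x x) = 0) : extDerSection θ x = 0 := by
  have h1 : chartForm (chartAt (Coord n) x) θ =ᶠ[𝓝 (chartAt (Coord n) x x)]
      localRep (chartAt (Coord n) x)
        (trivializationAt (FormModel n d) (FormBundle n d : X → Type _) x) θ := by
    filter_upwards [(chartAt (Coord n) x).open_target.mem_nhds (mem_chart_target _ x)] with y hy
    exact chartForm_chartAt_eq_localRep θ x hy
  -- `extDeriv` is the alternatization of `fderiv`, a linear operation.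
  have h2 : extDeriv (chartForm (chartAt (Coord n) x) θ) (chartAt (Coord n) x x) = 0 := by
    rw [extDeriv, h1.fderiv_eq, h]
    exact map_zero (ContinuousAlternatingMap.alternatizeUncurryFinCLM ℝ (Coord n) ℝ)
  exact congrArg (fun η : FormModel n (d + 1) => η.compContinuousLinearMap
      (mfderiv (𝓡 n) (𝓡 n) (chartAt (Coord n) x) x : Coord n →L[ℝ] Coord n)) h2

end FormPullback

/-! ### Operators that factor through a jet bundle -/

section JetFactorization

set_option linter.unusedSectionVars false

variable {n : ℕ} {X : Type*} [TopologicalSpace X] [ChartedSpace (Coord n) X]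

/-- Units of the complete algebra `E →L[ℝ] E` form an open set on which inversion is smooth, so `C =
L ∘ M⁻¹` near `x`. This gives smoothness of a family known only along a moving frame. -/
lemma contMDiffAt_of_comp_eq {E H : Type*} [NormedAddCommGroup E] [NormedSpace ℝ E]
    [CompleteSpace E] [NormedAddCommGroup H] [NormedSpace ℝ H] {x : X} {C L : X → E →L[ℝ] H}
    {M : X → E →L[ℝ] E} (hM : ContMDiffAt (𝓡 n) 𝓘(ℝ, E →L[ℝ] E) ∞ M x)
    (hL : ContMDiffAt (𝓡 n) 𝓘(ℝ, E →L[ℝ] H) ∞ L x) (hMx : M x = 1)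
    (h : ∀ᶠ z in 𝓝 x, ∀ v, C z (M z v) = L z v) :
    ContMDiffAt (𝓡 n) 𝓘(ℝ, E →L[ℝ] H) ∞ C x := by
  have hinv : ContMDiffAt (𝓡 n) 𝓘(ℝ, E →L[ℝ] E) ∞ (fun z => Ring.inverse (M z)) x := by
    have h1 : ContDiffAt ℝ ∞ (Ring.inverse : (E →L[ℝ] E) → _) (M x) := by
      rw [hMx]
      exact contDiffAt_ringInverse ℝ (1 : (E →L[ℝ] E)ˣ)
    exact h1.contMDiffAt.comp x hM
  have hunit : ∀ᶠ z in 𝓝 x, IsUnit (M z) := by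
    have : IsUnit (M x) := by rw [hMx]; exact isUnit_one
    exact hM.continuousAt.eventually (Units.isOpen.mem_nhds this)
  refine (hL.clm_comp hinv).congr_of_eventuallyEq ?_
  filter_upwards [hunit, h] with z hu hz
  ext1 v
  rw [ContinuousLinearMap.comp_apply, ← hz, ← mul_apply_eq_comp (M z),
    Ring.mul_inverse_cancel _ hu, one_apply_eq_self]

/-- A family of linear maps on a finite-dimensional space is smooth if it is so pointwise. -/
lemma exists_contMDiffAt_clm {E H : Type*} [NormedAddCommGroup E] [NormedSpace ℝ E]
    [FiniteDimensional ℝ E] [NormedAddCommGroup H] [NormedSpace ℝ H] {x : X} {U : Set X}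
    (f : X → E → H) (hf : ∀ v, ContMDiffAt (𝓡 n) 𝓘(ℝ, H) ∞ (fun z => f z v) x)
    (hlin : ∀ z ∈ U, IsLinearMap ℝ (f z)) :
    ∃ M : X → E →L[ℝ] H, ContMDiffAt (𝓡 n) 𝓘(ℝ, E →L[ℝ] H) ∞ M x ∧
      ∀ z ∈ U, ∀ v, M z v = f z v := by
  let b := Module.finBasis ℝ E
  let bc : Fin (Module.finrank ℝ E) → E →L[ℝ] ℝ := fun i => LinearMap.toContinuousLinearMap (b.coord i)
  -- On `U` linearity gives `f z v = ∑ bⁱ(v) f z (bᵢ)`. The right-hand side is linear in `v` at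
  -- every `z` and depends smoothly on `z` at `x`.
  refine ⟨fun z => ∑ i, (bc i).smulRight (f z (b i)), ?_, ?_⟩
  · refine ContMDiffAt.sum fun i _ => ?_
    exact ((ContinuousLinearMap.smulRightL ℝ E H (bc i)).contDiff.contMDiff.contMDiffAt).comp x
      (hf (b i))
  · intro z hz v
    have h5 := congrArg ((hlin z hz).mk' (f z)) (b.sum_repr v)
    rw [map_sum] at h5
    refine Eq.trans ?_ h5
    simp [bc]

variable [IsManifold (𝓡 n) ∞ X]
  {G : Type*} [NormedAddCommGroup G] [NormedSpace ℝ G] [FiniteDimensional ℝ G]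
  {V : X → Type*} [∀ x, AddCommGroup (V x)] [∀ x, Module ℝ (V x)]
  [∀ x, TopologicalSpace (V x)] [TopologicalSpace (TotalSpace G V)]
  [FiberBundle G V] [VectorBundle ℝ G V] [ContMDiffVectorBundle ∞ G V (𝓡 n)]
  {G' : Type*} [NormedAddCommGroup G'] [NormedSpace ℝ G']
  {V' : X → Type*} [∀ x, AddCommGroup (V' x)] [∀ x, Module ℝ (V' x)]
  [∀ x, TopologicalSpace (V' x)] [∀ x, IsTopologicalAddGroup (V' x)]
  [∀ x, ContinuousSMul ℝ (V' x)] [TopologicalSpace (TotalSpace G' V')]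
  [FiberBundle G' V'] [VectorBundle ℝ G' V'] [ContMDiffVectorBundle ∞ G' V' (𝓡 n)]

/-- A fibrewise linear map is smooth at `x` if it maps a linear family of sections that spans the
fibre at `x` to sections that are smooth at `x`. -/
lemma contMDiffAt_hom_of_sections (A : ∀ x, V x →L[ℝ] V' x) (x : X) (S : G →ₗ[ℝ] Sections n G V)
    (hS : ∀ v, (trivializationAt G V x ⟨x, S v x⟩).2 = v)
    (hA : ∀ v, ContMDiffAt (𝓡 n) ((𝓡 n).prod 𝓘(ℝ, G')) ∞
      (fun z => TotalSpace.mk' G' z (A z (S v z))) x) :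
    ContMDiffAt (𝓡 n) ((𝓡 n).prod 𝓘(ℝ, G →L[ℝ] G')) ∞
      (fun z => TotalSpace.mk' (G →L[ℝ] G') (E := fun z => V z →L[ℝ] V' z) z (A z)) x := by
  set e := trivializationAt G V x
  set e' := trivializationAt G' V' x
  set U := e.baseSet ∩ e'.baseSet with hU
  have hUx : U ∈ 𝓝 x := (e.open_baseSet.inter e'.open_baseSet).mem_nhds
    ⟨mem_baseSet_trivializationAt G V x, mem_baseSet_trivializationAt G' V' x⟩
  -- `M` reads the sections `S v` in the trivialization at `x`, and `L` reads their images under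
  -- `A`. The coordinate expression `C` of `A` satisfies `C ∘ M = L`, and `M x = 1` by the choice of
  -- `S`.
  obtain ⟨M, hM, hMv⟩ := exists_contMDiffAt_clm (n := n) (x := x) (U := U)
    (fun z v => (e ⟨z, S v z⟩).2)
    (fun v => (Bundle.contMDiffAt_section x).1 (S v).contMDiff.contMDiffAt)
    (fun z hz => (((e.linearEquivAt ℝ z hz.1).toLinearMap ∘ₗ
      (LinearMap.mk ⟨fun s : Sections n G V => s z, fun _ _ => rfl⟩ fun _ _ => rfl :
        Sections n G V →ₗ[ℝ] V z)) ∘ₗ S).isLinear)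
  obtain ⟨L, hL, hLv⟩ := exists_contMDiffAt_clm (n := n) (x := x) (U := U)
    (fun z v => (e' ⟨z, A z (S v z)⟩).2)
    (fun v => (Bundle.contMDiffAt_section x).1 (hA v))
    (fun z hz => (((e'.linearEquivAt ℝ z hz.2).toLinearMap ∘ₗ (A z).toLinearMap ∘ₗ
      (LinearMap.mk ⟨fun s : Sections n G V => s z, fun _ _ => rfl⟩ fun _ _ => rfl :
        Sections n G V →ₗ[ℝ] V z)) ∘ₗ S).isLinear)
  have : CompleteSpace G := FiniteDimensional.complete ℝ G
  rw [contMDiffAt_hom_bundle]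
  refine ⟨contMDiffAt_id, contMDiffAt_of_comp_eq hM hL ?_ ?_⟩
  · ext1 v
    rw [hMv x (mem_of_mem_nhds hUx)]
    exact hS v
  · filter_upwards [hUx] with z hz v
    rw [hMv z hz, hLv z hz, ContinuousLinearMap.inCoordinates_eq hz.1 hz.2]
    simp only [ContinuousLinearMap.comp_apply]
    have h1 : (e.continuousLinearEquivAt ℝ z hz.1).symm (e ⟨z, S v z⟩).2 = S v z :=
      (e.continuousLinearEquivAt ℝ z hz.1).symm_apply_apply (S v z)
    exact congrArg (fun u => (e' ⟨z, A z u⟩).2) h1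

variable [T2Space X]

/-- A fibre of the jet bundle is homeomorphic, through a trivialization, to the finite-dimensional
model, where linear maps are continuous. -/
lemma continuous_of_linear_jetBundle (k : ℕ) (x : X) (A : JetBundle n G V k x →ₗ[ℝ] V' x) :
    Continuous A := by
  let e := (trivializationAt (JetModel n k G) (JetBundle n G V k) x).continuousLinearEquivAt ℝ x
    (mem_baseSet_trivializationAt _ _ x)
  have h1 : Continuous (A ∘ₗ e.symm.toLinearEquiv.toLinearMap) :=
    LinearMap.continuous_of_finiteDimensional _
  have h2 := h1.comp e.continuous
  convert h2 using 1
  ext p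
  simp

/-- A fibrewise linear map on a jet bundle is smooth if it is so on jet extensions. -/
lemma contMDiffAt_hom_of_jets (k : ℕ) (A : ∀ x, JetBundle n G V k x →L[ℝ] V' x) (x : X)
    (hA : ∀ s : Sections n G V, ContMDiffAt (𝓡 n) ((𝓡 n).prod 𝓘(ℝ, G')) ∞
      (fun z => TotalSpace.mk' G' z (A z (jet k s z))) x) :
    ContMDiffAt (𝓡 n) ((𝓡 n).prod 𝓘(ℝ, JetModel n k G →L[ℝ] G')) ∞
      (fun z => TotalSpace.mk' (JetModel n k G →L[ℝ] G')
        (E := fun z => JetBundle n G V k z →L[ℝ] V' z) z (A z)) x := by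
  let e : JetBundle n G V k x ≃ₗ[ℝ] JetModel n k G := jetCoordEquiv k (chart_mem x)
    (trivializationAt G V x) (mem_chart_source _ x) (mem_baseSet_trivializationAt G V x)
  -- A linear choice of sections of `V` with prescribed jet coordinates at `x`. Their jet extensions
  -- already span the fibre at `x`, so arbitrary sections of the jet bundle need not be tested.
  obtain ⟨S, hS⟩ := LinearMap.exists_rightInverse_of_surjective (e.toLinearMap ∘ₗ jetAt k x)
    (LinearMap.range_eq_top.2 (e.surjective.comp (jetAt_surjective k x)))
  let jl : Sections n G V →ₗ[ℝ] Sections n (JetModel n k G) (JetBundle n G V k) :=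
    { toFun := jet k
      map_add' := fun s t => by ext1 z; exact map_add (jetAt k z : Sections n G V →ₗ[ℝ] _) s t
      map_smul' := fun a s => by
        ext1 z; exact map_smul (jetAt k z : Sections n G V →ₗ[ℝ] _) a s }
  exact contMDiffAt_hom_of_sections A x (jl ∘ₗ S) (fun v => LinearMap.congr_fun hS v)
    fun v => hA (S v)

/-- An operator on sections that depends only on the `k`-jet factors through a smooth morphism
from the `k`-jet bundle. -/
lemma exists_jet_factorization (k : ℕ) (T : Sections n G V →ₗ[ℝ] Sections n G' V')
    (hT : ∀ x s, jetAt k x s = 0 → T s x = 0) :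
    ∃ Φ : Sections n (JetModel n k G →L[ℝ] G') (fun x => JetBundle n G V k x →L[ℝ] V' x),
      ∀ s x, T s x = Φ x (jet k s x) := by
  -- The fibre is the quotient of global sections by those with vanishing jet, so the hypothesis on
  -- `T` is exactly what lets the value at `x` descend.
  let A : ∀ x, JetBundle n G V k x →L[ℝ] V' x := fun x =>
    { toLinearMap := (vanishing n G V k x).liftQ
        ((LinearMap.mk ⟨fun s : Sections n G' V' => s x, fun _ _ => rfl⟩ fun _ _ => rfl :
          Sections n G' V' →ₗ[ℝ] V' x) ∘ₗ T)
        (fun s hs => hT x s ((Submodule.Quotient.mk_eq_zero _).2 hs))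
      cont := continuous_of_linear_jetBundle k x _ }
  have hA : ∀ s x, T s x = A x (jetAt k x s) := fun s x => rfl
  refine ⟨⟨A, fun x => ?_⟩, hA⟩
  exact contMDiffAt_hom_of_jets k A x fun s => (T s).contMDiff.contMDiffAt

end JetFactorization

/-! ### The pairing of sections and its Leibniz rule -/

section Pairing

set_option linter.unusedSectionVars false

variable {n : ℕ} {X : Type*} [TopologicalSpace X] [ChartedSpace (Coord n) X]
  [IsManifold (𝓡 n) ∞ X]
  {G : Type*} [NormedAddCommGroup G] [NormedSpace ℝ G]
  {V : X → Type*} [∀ x, AddCommGroup (V x)] [∀ x, Module ℝ (V x)]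
  [∀ x, TopologicalSpace (V x)] [TopologicalSpace (TotalSpace G V)]
  [FiberBundle G V] [VectorBundle ℝ G V] [ContMDiffVectorBundle ∞ G V (𝓡 n)]
  {G' : Type*} [NormedAddCommGroup G'] [NormedSpace ℝ G']
  {V' : X → Type*} [∀ x, AddCommGroup (V' x)] [∀ x, Module ℝ (V' x)]
  [∀ x, TopologicalSpace (V' x)] [∀ x, IsTopologicalAddGroup (V' x)]
  [∀ x, ContinuousSMul ℝ (V' x)] [TopologicalSpace (TotalSpace G' V')]
  [FiberBundle G' V'] [VectorBundle ℝ G' V'] [ContMDiffVectorBundle ∞ G' V' (𝓡 n)]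

/-- The section `x ↦ σ x (λ x)`. -/
def applySection (σ : Sections n (G →L[ℝ] G') (fun x => V x →L[ℝ] V' x)) :
    Sections n G V →ₗ[ℝ] Sections n G' V' where
  toFun lam := ⟨fun x => σ x (lam x), fun x =>
    σ.contMDiff.contMDiffAt.clm_bundle_apply lam.contMDiff.contMDiffAt⟩
  map_add' s t := by ext1 x; exact map_add (σ x) (s x) (t x)
  map_smul' a s := by ext1 x; exact map_smul (σ x) a (s x)

lemma applySection_add (σ τ : Sections n (G →L[ℝ] G') (fun x => V x →L[ℝ] V' x))
    (lam : Sections n G V) :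
    applySection (σ + τ) lam = applySection σ lam + applySection τ lam := rfl

lemma applySection_smul (a : ℝ) (σ : Sections n (G →L[ℝ] G') (fun x => V x →L[ℝ] V' x))
    (lam : Sections n G V) : applySection (a • σ) lam = a • applySection σ lam := rfl

/-- The trivialization of the bundle of linear maps conjugates by the trivializations of `V` and
`V'`, so evaluation commutes with taking representatives wherever both are defined. -/
lemma localRep_applySection (σ : Sections n (G →L[ℝ] G') (fun x => V x →L[ℝ] V' x))
    (lam : Sections n G V) (x : X) :
    localRep (chartAt (Coord n) x) (trivializationAt G' V' x) (applySection σ lam)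
      =ᶠ[𝓝 (chartAt (Coord n) x x)] fun y =>
        (localRep (chartAt (Coord n) x)
          (trivializationAt (G →L[ℝ] G') (fun x => V x →L[ℝ] V' x) x) σ y)
        (localRep (chartAt (Coord n) x) (trivializationAt G V x) lam y) := by
  set c := chartAt (Coord n) x
  have hc : ContinuousAt c.symm (c x) := c.symm.continuousAt (mem_chart_target _ x)
  have hU : (trivializationAt G V x).baseSet ∩ (trivializationAt G' V' x).baseSet ∈
      𝓝 (c.symm (c x)) := by
    rw [c.left_inv (mem_chart_source _ x)]
    exact ((trivializationAt G V x).open_baseSet.inter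
      (trivializationAt G' V' x).open_baseSet).mem_nhds
        ⟨mem_baseSet_trivializationAt G V x, mem_baseSet_trivializationAt G' V' x⟩
  filter_upwards [hc hU] with y hy
  simp only [localRep, hom_trivializationAt_apply]
  rw [ContinuousLinearMap.inCoordinates_eq hy.1 hy.2]
  simp only [ContinuousLinearMap.comp_apply]
  have h1 : ((trivializationAt G V x).continuousLinearEquivAt ℝ _ hy.1).symm
      (trivializationAt G V x ⟨c.symm y, lam (c.symm y)⟩).2 = lam (c.symm y) :=
    ((trivializationAt G V x).continuousLinearEquivAt ℝ _ hy.1).symm_apply_apply _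
  exact congrArg (fun u => (trivializationAt G' V' x ⟨c.symm y, σ (c.symm y) u⟩).2) h1.symm

lemma Flat.fderiv_eq_zero {H : Type*} [NormedAddCommGroup H] [NormedSpace ℝ H] {f : Coord n → H}
    {y : Coord n} (h : Flat 1 f y) : fderiv ℝ f y = 0 := by
  have h1 : ((fderiv ℝ f y : Coord n →L[ℝ] H) : Coord n →ₗ[ℝ] H) = 0 :=
    (EuclideanSpace.basisFun (Fin n) ℝ).toBasis.ext fun i => by
      simpa [multiDeriv, HyperStress.pderiv] using h [i] (by simp)
  exact ContinuousLinearMap.coe_injective h1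

lemma flat_localRep_of_jetAt_eq_zero {k : ℕ} {s : Sections n G V} {x : X} (h : jetAt k x s = 0) :
    Flat k (localRep (chartAt (Coord n) x) (trivializationAt G V x) s) (chartAt (Coord n) x x) :=
  (Submodule.Quotient.mk_eq_zero _).1 h

/-- In `D(σλ) = Dσ · λ + σ · Dλ` each term contains the value or the derivative of either factor,
and a vanishing 1-jet kills both value and derivative. The alternative `jetAt 1 x lam = 0` serves to
construct `𝔡σ`, and the other to bound the order of `𝔡`. -/
lemma fderiv_localRep_applySection (σ : Sections n (G →L[ℝ] G') (fun x => V x →L[ℝ] V' x))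
    (lam : Sections n G V) (x : X) (h : jetAt 1 x σ = 0 ∨ jetAt 1 x lam = 0) :
    fderiv ℝ (localRep (chartAt (Coord n) x) (trivializationAt G' V' x) (applySection σ lam))
      (chartAt (Coord n) x x) = 0 := by
  have d1 := (contDiffAt_localRep (chart_mem x) (trivializationAt (G →L[ℝ] G')
    (fun x => V x →L[ℝ] V' x) x) σ (mem_chart_source _ x)
    (mem_baseSet_trivializationAt _ _ x)).differentiableAt (by simp)
  have d2 := (contDiffAt_localRep (chart_mem x) (trivializationAt G V x) lam
    (mem_chart_source _ x) (mem_baseSet_trivializationAt _ _ x)).differentiableAt (by simp)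
  rw [(localRep_applySection σ lam x).fderiv_eq, fderiv_clm_apply d1 d2]
  rcases h with h | h
  · have hf := flat_localRep_of_jetAt_eq_zero h
    have h0 := hf [] (by simp)
    simp only [multiDeriv] at h0
    rw [h0, hf.fderiv_eq_zero]
    ext v
    simp
  · have hf := flat_localRep_of_jetAt_eq_zero h
    have h0 := hf [] (by simp)
    simp only [multiDeriv] at h0
    rw [h0, hf.fderiv_eq_zero]
    ext v
    simp

end Pairing

/-! ### The exterior jet: existence, uniqueness, order one, naturality -/

section ExteriorJetOperator

variable {m : ℕ} {X : Type*} [TopologicalSpace X] [ChartedSpace (Coord (m + 1)) X]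
  [IsManifold (𝓡 (m + 1)) ∞ X] [T2Space X]
  {F : Type*} [NormedAddCommGroup F] [NormedSpace ℝ F] [FiniteDimensional ℝ F]
  {W : X → Type*} [∀ x, AddCommGroup (W x)] [∀ x, Module ℝ (W x)]
  [∀ x, TopologicalSpace (W x)] [TopologicalSpace (TotalSpace F W)]
  [FiberBundle F W] [VectorBundle ℝ F W] [ContMDiffVectorBundle ∞ F W (𝓡 (m + 1))] {r : ℕ}

/-- The operator `λ ↦ d(σ · λ)` is linear and kills, at each point, the sections whose 1-jet
vanishes there. -/
lemma exists_isExteriorJetOf (σ : TractionField m F W r) :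
    ∃ τ : StressField m F W r, IsExteriorJetOf σ τ := by
  obtain ⟨τ, hτ⟩ := exists_jet_factorization 1 (extDerSection ∘ₗ applySection σ)
    (fun x lam h => extDerSection_eq_zero _ x (fderiv_localRep_applySection σ lam x (Or.inr h)))
  exact ⟨τ, fun lam x => (hτ lam x).symm⟩

/-- Every element of a fibre of the 1-jet bundle is the jet of a global section, so the defining
relation fixes all values. -/
lemma IsExteriorJetOf.unique {σ : TractionField m F W r} {τ τ' : StressField m F W r}
    (h : IsExteriorJetOf σ τ) (h' : IsExteriorJetOf σ τ') : τ = τ' := by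
  ext1 x
  ext1 p
  obtain ⟨lam, rfl⟩ := jetAt_surjective 1 x p
  exact (h lam x).trans (h' lam x).symm

lemma IsExteriorJetOf.apply {σ : TractionField m F W r} {τ : StressField m F W r}
    (h : IsExteriorJetOf σ τ)
    (lam : Sections (m + 1) (JetModel (m + 1) r F) (JetBundle (m + 1) F W r)) (x : X) :
    τ x (jet 1 lam x) = extDerSection (applySection σ lam) x := h lam x

/-- The exterior jet of a traction field. -/
def exteriorJet : TractionField m F W r →ₗ[ℝ] StressField m F W r where
  toFun σ := (exists_isExteriorJetOf σ).choose
  map_add' σ σ' := by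
    -- The values are chosen separately for each `σ`; additivity follows because the sum of two
    -- exterior jets satisfies the relation that characterizes the exterior jet of the sum.
    refine (exists_isExteriorJetOf (σ + σ')).choose_spec.unique fun lam x => ?_
    change (exists_isExteriorJetOf σ).choose x (jet 1 lam x) +
      (exists_isExteriorJetOf σ').choose x (jet 1 lam x) =
        extDerSection (applySection (σ + σ') lam) x
    rw [(exists_isExteriorJetOf σ).choose_spec.apply, (exists_isExteriorJetOf σ').choose_spec.apply,
      applySection_add, map_add]
    rfl
  map_smul' a σ := by
    refine (exists_isExteriorJetOf (a • σ)).choose_spec.unique fun lam x => ?_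
    change a • (exists_isExteriorJetOf σ).choose x (jet 1 lam x) =
        extDerSection (applySection (a • σ) lam) x
    rw [(exists_isExteriorJetOf σ).choose_spec.apply, applySection_smul, map_smul]
    rfl

lemma isExteriorJetOf_exteriorJet (σ : TractionField m F W r) :
    IsExteriorJetOf σ (exteriorJet σ) := (exists_isExteriorJetOf σ).choose_spec

/-- The same factorization, now with `σ` as the variable: if `j¹σ` vanishes at `x`, then `d(σ · λ)`
vanishes at `x` for all `λ`, hence `𝔡σ` vanishes on every jet at `x`. -/
lemma isDiffOp_exteriorJet :
    IsDiffOp 1 (exteriorJet : TractionField m F W r →ₗ[ℝ] StressField m F W r) := by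
  have hV (x : X) : IsTopologicalAddGroup (JetBundle (m + 1) (JetModel (m + 1) r F)
      (JetBundle (m + 1) F W r) 1 x →L[ℝ] FormBundle (m + 1) (m + 1) x) :=
    ContinuousLinearMap.topologicalAddGroup
  have hV' (x : X) : ContinuousSMul ℝ (JetBundle (m + 1) (JetModel (m + 1) r F)
      (JetBundle (m + 1) F W r) 1 x →L[ℝ] FormBundle (m + 1) (m + 1) x) :=
    ContinuousLinearMap.continuousSMul
  refine exists_jet_factorization
    (V := fun x : X => JetBundle (m + 1) F W r x →L[ℝ] FormBundle (m + 1) m x)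
    (V' := fun x : X => JetBundle (m + 1) (JetModel (m + 1) r F) (JetBundle (m + 1) F W r) 1 x →L[ℝ]
      FormBundle (m + 1) (m + 1) x) 1 exteriorJet fun x σ h => ?_
  ext1 p
  obtain ⟨lam, rfl⟩ := jetAt_surjective 1 x p
  exact ((isExteriorJetOf_exteriorJet σ).apply lam x).trans
    (extDerSection_eq_zero _ x (fderiv_localRep_applySection σ lam x (Or.inl h)))


/-- The exterior jet commutes with pullbacks. -/
lemma exteriorJet_natural {X' : Type*} [TopologicalSpace X'] [ChartedSpace (Coord (m + 1)) X']
    [IsManifold (𝓡 (m + 1)) ∞ X'] [T2Space X']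
    {F' : Type*} [NormedAddCommGroup F'] [NormedSpace ℝ F'] [FiniteDimensional ℝ F']
    {W' : X' → Type*} [∀ x, AddCommGroup (W' x)] [∀ x, Module ℝ (W' x)]
    [∀ x, TopologicalSpace (W' x)] [TopologicalSpace (TotalSpace F' W')]
    [FiberBundle F' W'] [VectorBundle ℝ F' W'] [ContMDiffVectorBundle ∞ F' W' (𝓡 (m + 1))]
    {φ : X → X'} (hφ : ContMDiff (𝓡 (m + 1)) (𝓡 (m + 1)) ∞ φ)
    (R : ∀ x, JetBundle (m + 1) F W r x → JetBundle (m + 1) F' W' r (φ x) → Prop)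
    {σ : TractionField m F W r} {σ' : TractionField m F' W' r} {τ : StressField m F W r}
    {τ' : StressField m F' W' r}
    (h : FormRel φ R (fun x p => σ x p) (fun x p => σ' x p)) (hτ : IsExteriorJetOf σ τ)
    (hτ' : IsExteriorJetOf σ' τ') :
    FormRel φ (JetRel φ R 1) (fun x p => τ x p) (fun x p => τ' x p) := by
  rintro x _ _ ⟨lam, lam', hR, rfl, rfl⟩
  -- The sections witnessing the relation of 1-jets are related at every point, so `σ · lam` is the
  -- pullback of `σ' · lam'` on all of `X`, and not merely at `x`; this is what allows
  -- differentiation.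
  have h1 := extDer_pullback hφ (θ := fun z => σ z (lam z)) (applySection σ' lam')
    (fun z => h z _ _ (hR z)) x
  refine (hτ lam x).trans (h1.trans ?_)
  exact congrArg (fun η : FormModel (m + 1) (m + 1) => η.compContinuousLinearMap
    (mfderiv (𝓡 (m + 1)) (𝓡 (m + 1)) φ x : Coord (m + 1) →L[ℝ] Coord (m + 1)))
      (hτ' lam' (φ x)).symm

end ExteriorJetOperator

/-! ### Forms of degree `n` and `n - 1` on `ℝⁿ` -/

section CoordinateForms

variable {m : ℕ}

lemma volForm_single (n : ℕ) : volForm n (fun i => EuclideanSpace.single i 1) = 1 := by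
  rw [volForm_apply]
  convert Matrix.det_one (n := Fin n) (R := ℝ) using 2
  ext i j
  simp [Matrix.one_apply]

lemma eq_smul_volForm {n : ℕ} (η : FormModel n n) :
    η = η (fun i => EuclideanSpace.single i 1) • volForm n := by
  have h := η.toAlternatingMap.eq_smul_basis_det (EuclideanSpace.basisFun (Fin n) ℝ).toBasis
  ext v
  have h2 := congrArg (fun f : (Coord n) [⋀^Fin n]→ₗ[ℝ] ℝ => f v) h
  have h3 : ⇑(EuclideanSpace.basisFun (Fin n) ℝ).toBasis =
      fun i => EuclideanSpace.single i (1 : ℝ) := by ext i; simp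
  rw [h3] at h2
  exact h2

/-- Inserting `eⱼ` in the first slot rearranges the standard basis by the inverse of the cycle
`j.cycleRange`, whose sign is `(-1)^j`. -/
lemma curryLeft_volForm_self (j : Fin (m + 1)) :
    (volForm (m + 1)).curryLeft (EuclideanSpace.single j 1)
      (fun i => EuclideanSpace.single (j.succAbove i) 1) = (-1) ^ (j : ℕ) := by
  have h1 : (Matrix.vecCons (EuclideanSpace.single j (1 : ℝ))
      fun i => EuclideanSpace.single (j.succAbove i) (1 : ℝ)) =
        (fun i => EuclideanSpace.single i (1 : ℝ)) ∘ j.cycleRange.symm := by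
    ext1 i
    refine Fin.cases ?_ (fun k => ?_) i
    · simp [Fin.cycleRange_symm_zero]
    · simp [Fin.cycleRange_symm_succ]
  rw [ContinuousAlternatingMap.curryLeft_apply_apply, h1]
  have h2 := (volForm (m + 1)).toAlternatingMap.map_perm
    (fun i => EuclideanSpace.single i (1 : ℝ)) j.cycleRange.symm
  refine h2.trans ?_
  have h3 : (volForm (m + 1)).toAlternatingMap (fun i => EuclideanSpace.single i (1 : ℝ)) = 1 :=
    volForm_single (m + 1)
  rw [h3, Equiv.Perm.sign_symm, Fin.sign_cycleRange]
  simp [Units.smul_def]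

lemma curryLeft_volForm_ne {j k : Fin (m + 1)} (h : k ≠ j) :
    (volForm (m + 1)).curryLeft (EuclideanSpace.single k 1)
      (fun i => EuclideanSpace.single (j.succAbove i) 1) = 0 := by
  -- The vector `e_k` now occurs twice, in slot `0` and in slot `i.succ`.
  obtain ⟨i, rfl⟩ := Fin.exists_succAbove_eq h
  rw [ContinuousAlternatingMap.curryLeft_apply_apply]
  exact (volForm (m + 1)).map_eq_zero_of_eq (i := 0) (j := i.succ) _ (by simp)
    (Fin.succ_ne_zero i).symm

/-- The coefficient of `eⱼ ⌟ (dy¹ ∧ ⋯ ∧ dyⁿ)` in an `(n - 1)`-form on `ℝⁿ`. -/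
def contrCoeff (j : Fin (m + 1)) : FormModel (m + 1) m →L[ℝ] ℝ :=
  LinearMap.toContinuousLinearMap
    { toFun := fun η => (-1) ^ (j : ℕ) * η (fun i => EuclideanSpace.single (j.succAbove i) 1)
      map_add' := fun η η' => by
        simp only [ContinuousAlternatingMap.add_apply]
        ring
      map_smul' := fun a η => by
        simp only [ContinuousAlternatingMap.smul_apply, smul_eq_mul, RingHom.id_apply]
        ring }

lemma contrCoeff_apply (j : Fin (m + 1)) (η : FormModel (m + 1) m) :
    contrCoeff j η = (-1) ^ (j : ℕ) * η (fun i => EuclideanSpace.single (j.succAbove i) 1) := rfl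

/-- The sign in `contrCoeff` cancels that of `curryLeft_volForm_self`, so these functionals are dual
to the forms `eₖ ⌟ dy`. -/
lemma contrCoeff_curryLeft (j k : Fin (m + 1)) :
    contrCoeff j ((volForm (m + 1)).curryLeft (EuclideanSpace.single k 1)) =
      if k = j then 1 else 0 := by
  rw [contrCoeff_apply]
  split_ifs with h
  · subst h
    rw [curryLeft_volForm_self, ← mul_pow]
    simp
  · rw [curryLeft_volForm_ne h, mul_zero]

lemma contrCoeff_sum (a : Fin (m + 1) → ℝ) (j : Fin (m + 1)) :
    contrCoeff j (∑ k, a k • (volForm (m + 1)).curryLeft (EuclideanSpace.single k 1)) = a j := by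
  simp [map_sum, contrCoeff_curryLeft]

/-- An alternating form is determined by its values on tuples of distinct basis vectors. A tuple of
`m` distinct vectors out of `m + 1` omits some `eⱼ`, so up to a permutation it is the tuple tested
by `contrCoeff j`. -/
lemma FormModel.ext_contrCoeff {η η' : FormModel (m + 1) m}
    (h : ∀ j, contrCoeff j η = contrCoeff j η') : η = η' := by
  have hj : ∀ j : Fin (m + 1), η (fun i => EuclideanSpace.single (j.succAbove i) 1) =
      η' (fun i => EuclideanSpace.single (j.succAbove i) 1) := fun j => by
    have := h j
    rw [contrCoeff_apply, contrCoeff_apply] at this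
    exact mul_left_cancel₀ (by simp) this
  have key : η.toAlternatingMap = η'.toAlternatingMap := by
    refine Module.Basis.ext_alternating (EuclideanSpace.basisFun (Fin (m + 1)) ℝ).toBasis
      fun v hv => ?_
    obtain ⟨j, hjv⟩ : ∃ j, ∀ i, v i ≠ j := by
      by_contra! hc
      have := Fintype.card_le_of_surjective v hc
      simp at this
    choose q hq using fun i => Fin.exists_succAbove_eq (hjv i)
    have hinj : Function.Injective q := fun a b hab => hv (by rw [← hq a, ← hq b, hab])
    let ρ : Equiv.Perm (Fin m) := Equiv.ofBijective q (Finite.injective_iff_bijective.1 hinj)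
    have h1 : (fun i => (EuclideanSpace.basisFun (Fin (m + 1)) ℝ).toBasis (v i)) =
        (fun i => EuclideanSpace.single (j.succAbove i) (1 : ℝ)) ∘ ρ := by
      ext1 i
      simp [ρ, hq]
    rw [h1, AlternatingMap.map_perm, AlternatingMap.map_perm]
    exact congrArg _ (hj j)
  ext v
  exact congrArg (fun f : (Coord (m + 1)) [⋀^Fin m]→ₗ[ℝ] ℝ => f v) key

lemma sum_contrCoeff (η : FormModel (m + 1) m) :
    ∑ j, contrCoeff j η • (volForm (m + 1)).curryLeft (EuclideanSpace.single j 1) = η :=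
  FormModel.ext_contrCoeff fun j => contrCoeff_sum (fun k => contrCoeff k η) j

/-- The exterior derivative of an `(n - 1)`-form on `ℝⁿ` is the divergence of its coefficients. -/
lemma extDeriv_eq_sum_pderiv {η : Coord (m + 1) → FormModel (m + 1) m} {y : Coord (m + 1)}
    (h : DifferentiableAt ℝ η y) :
    extDeriv η y = (∑ j, pderiv j (fun z => contrCoeff j (η z)) y) • volForm (m + 1) := by
  -- A top-degree form is its value on the standard basis times `volForm`. That value of `extDeriv
  -- η` is the alternating sum of the `∂ⱼ` of `η` on the basis with `eⱼ` removed, and the signs are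
  -- those of `contrCoeff`.
  rw [eq_smul_volForm (extDeriv η y), extDeriv_apply h]
  congr 1
  refine Finset.sum_congr rfl fun j _ => ?_
  have hd : DifferentiableAt ℝ
      (fun z => η z (j.removeNth fun i => EuclideanSpace.single i (1 : ℝ))) y := by
    have h1 := ((LinearMap.toContinuousLinearMap
      { toFun := fun θ : FormModel (m + 1) m =>
          θ (j.removeNth fun i => EuclideanSpace.single i (1 : ℝ))
        map_add' := fun _ _ => rfl
        map_smul' := fun _ _ => rfl } : FormModel (m + 1) m →L[ℝ] ℝ).differentiableAt).comp y h
    exact h1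
  change _ = fderiv ℝ (fun z => (-1) ^ (j : ℕ) *
    η z (j.removeNth fun i => EuclideanSpace.single i (1 : ℝ))) y _
  rw [fderiv_const_mul hd, smul_apply, zsmul_eq_mul, smul_eq_mul]
  push_cast
  rfl

end CoordinateForms

/-! ### Components of jets in a local frame -/

section FrameComponents

set_option linter.unusedSectionVars false

variable {n : ℕ} {X : Type*} [TopologicalSpace X] [ChartedSpace (Coord n) X] [IsManifold (𝓡 n) ∞ X]
  {F : Type*} [NormedAddCommGroup F] [NormedSpace ℝ F] [FiniteDimensional ℝ F]
  {W : X → Type*} [∀ x, AddCommGroup (W x)] [∀ x, Module ℝ (W x)]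
  [∀ x, TopologicalSpace (W x)] [TopologicalSpace (TotalSpace F W)]
  [FiberBundle F W] [VectorBundle ℝ F W] [ContMDiffVectorBundle ∞ F W (𝓡 n)]
  {ν : ℕ} {s : Fin ν → ∀ x, W x} {φ : OpenPartialHomeomorph X (Coord n)}

lemma contDiffAt_frameRep (hφ : φ ∈ IsManifold.maximalAtlas (𝓡 n) ∞ X)
    (hs : IsLocalFrameOn (𝓡 n) F ∞ s φ.source) (α : Fin ν) (w : Sections n F W) {x : X}
    (hx : x ∈ φ.source) : ContDiffAt ℝ ∞ (frameRep hs α w) (φ x) := by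
  obtain ⟨G, hG, hGw⟩ := exists_frameRep_eq hφ hs α hx
  exact (hG.clm_apply (contDiffAt_localRep hφ _ w hx
    (mem_baseSet_trivializationAt F W x))).congr_of_eventuallyEq (hGw w)

/-- Every array of functions is locally the array of components of a section. -/
lemma exists_section_frameRep [T2Space X] (hφ : φ ∈ IsManifold.maximalAtlas (𝓡 n) ∞ X)
    (hs : IsLocalFrameOn (𝓡 n) F ∞ s φ.source) {x : X} (hx : x ∈ φ.source)
    {f : Fin ν → Coord n → ℝ} (hf : ∀ α, ContDiff ℝ ∞ (f α)) :
    ∃ w : Sections n F W, ∀ α, frameRep hs α w =ᶠ[𝓝 (φ x)] f α := by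
  -- A bump function supported in the chart domain and equal to `1` near `x` extends `∑ f^α s_α` to
  -- a global section without changing its germ at `x`.
  obtain ⟨b, -, hb⟩ := (SmoothBumpFunction.nhds_basis_tsupport (I := 𝓡 n) x).mem_iff.1
    (φ.open_source.mem_nhds hx)
  set t : ∀ z, W z := fun z => ∑ α, f α (φ z) • s α z with ht
  have hts : ContMDiffOn (𝓡 n) ((𝓡 n).prod 𝓘(ℝ, F)) ∞ (fun z => TotalSpace.mk' F z (t z))
      φ.source := by
    refine ContMDiffOn.sum_section fun α _ => ?_
    exact ContMDiffOn.smul_section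
      ((hf α).contMDiff.comp_contMDiffOn (contMDiffOn_of_mem_maximalAtlas hφ)) (hs.contMDiffOn α)
  refine ⟨⟨(b : X → ℝ) • t, ContMDiffOn.smul_section_of_tsupport b.contMDiff.contMDiffOn
    φ.open_source hb hts⟩, fun α => ?_⟩
  have hc : ContinuousAt φ.symm (φ x) := φ.symm.continuousAt (φ.map_source hx)
  have h1 : {z | b z = 1} ∈ 𝓝 (φ.symm (φ x)) := by
    rw [φ.left_inv hx]
    exact b.eventuallyEq_one
  filter_upwards [hc h1, φ.open_target.mem_nhds (φ.map_source hx)] with y hy hyt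
  have hy1 : b (φ.symm y) = 1 := hy
  have hys := φ.map_target hyt
  change hs.coeff α (φ.symm y) (b (φ.symm y) • t (φ.symm y)) = _
  rw [hy1, one_smul, hs.coeff_apply_of_mem hys t, ht]
  have h2 : ∑ β, f β (φ (φ.symm y)) • s β (φ.symm y) =
      ∑ β, f β (φ (φ.symm y)) • hs.toBasisAt hys β := by simp
  change (hs.toBasisAt hys).repr (∑ β, f β (φ (φ.symm y)) • s β (φ.symm y)) α = f α y
  rw [h2, (hs.toBasisAt hys).repr_sum_self, φ.right_inv hyt]

/-- The components of a jet in a local frame, as a linear map. -/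
def jetComps (hφ : φ ∈ IsManifold.maximalAtlas (𝓡 n) ∞ X)
    (hs : IsLocalFrameOn (𝓡 n) F ∞ s φ.source) (r : ℕ) {x : X} (hx : x ∈ φ.source) :
    JetBundle n F W r x →ₗ[ℝ] (Fin ν × MultiIndex n r → ℝ) where
  toFun p i := jetComp hs i.1 i.2 x p
  map_add' p q := by
    obtain ⟨w, rfl⟩ := jetAt_surjective r x p
    obtain ⟨w', rfl⟩ := jetAt_surjective r x q
    ext i
    have h1 : frameRep hs i.1 (w + w' : Sections n F W) =
        frameRep hs i.1 w + frameRep hs i.1 w' := by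
      ext y
      exact map_add (hs.coeff i.1 (φ.symm y)) (w (φ.symm y)) (w' (φ.symm y))
    rw [← map_add, Pi.add_apply, jetComp_jetAt hφ hs _ _ hx, jetComp_jetAt hφ hs _ _ hx,
      jetComp_jetAt hφ hs _ _ hx, h1, (multiDeriv_add (contDiffAt_frameRep hφ hs _ w hx)
        (contDiffAt_frameRep hφ hs _ w' hx) _).eq_of_nhds, Pi.add_apply]
  map_smul' a p := by
    obtain ⟨w, rfl⟩ := jetAt_surjective r x p
    ext i
    have h1 : frameRep hs i.1 (a • w : Sections n F W) = a • frameRep hs i.1 w := by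
      ext y
      exact map_smul (hs.coeff i.1 (φ.symm y)) a (w (φ.symm y))
    rw [← map_smul, Pi.smul_apply, jetComp_jetAt hφ hs _ _ hx, jetComp_jetAt hφ hs _ _ hx, h1,
      (multiDeriv_smul a (contDiffAt_frameRep hφ hs _ w hx) _).eq_of_nhds]
    rfl

/-- Polynomials with the prescribed derivatives at `φ x` serve as components of a section near `x`.
-/
lemma jetComps_surjective [T2Space X] (hφ : φ ∈ IsManifold.maximalAtlas (𝓡 n) ∞ X)
    (hs : IsLocalFrameOn (𝓡 n) F ∞ s φ.source) (r : ℕ) {x : X} (hx : x ∈ φ.source) :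
    Function.Surjective (jetComps hφ hs r hx) := by
  intro v
  choose f hf hfv using fun α => exists_polynomial (φ x) fun J : MultiIndex n r => v (α, J)
  obtain ⟨w, hw⟩ := exists_section_frameRep hφ hs hx hf
  refine ⟨jetAt r x w, ?_⟩
  ext i
  refine (jetComp_jetAt hφ hs i.1 i.2 hx w).trans ?_
  rw [(multiDeriv_congr (hw i.1) _).eq_of_nhds, hfv]

/-- A dimension count: the frame is a basis of the fibre at `x`, so `ν` is the rank of `W` and
source and target have the same dimension; surjectivity then gives injectivity. -/
lemma jetComps_injective [T2Space X] (hφ : φ ∈ IsManifold.maximalAtlas (𝓡 n) ∞ X)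
    (hs : IsLocalFrameOn (𝓡 n) F ∞ s φ.source) (r : ℕ) {x : X} (hx : x ∈ φ.source) :
    Function.Injective (jetComps hφ hs r hx) := by
  let e := jetCoordEquiv (W := W) r hφ (trivializationAt F W x) hx
    (mem_baseSet_trivializationAt F W x)
  have hfin : FiniteDimensional ℝ (JetBundle n F W r x) := e.symm.finiteDimensional
  have hν : ν = Module.finrank ℝ F := by
    rw [← ((trivializationAt F W x).linearEquivAt ℝ x
      (mem_baseSet_trivializationAt F W x)).finrank_eq, Module.finrank_eq_card_basis (hs.toBasisAt hx),
      Fintype.card_fin]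
  refine (LinearMap.injective_iff_surjective_of_finrank_eq_finrank ?_).2
    (jetComps_surjective hφ hs r hx)
  rw [e.finrank_eq, Module.finrank_pi_fintype]
  simp [hν, mul_comm]

/-- The components of jets in a local frame are coordinates of the fibre of the jet bundle. -/
def jetCompsEquiv [T2Space X] (hφ : φ ∈ IsManifold.maximalAtlas (𝓡 n) ∞ X)
    (hs : IsLocalFrameOn (𝓡 n) F ∞ s φ.source) (r : ℕ) {x : X} (hx : x ∈ φ.source) :
    JetBundle n F W r x ≃ₗ[ℝ] (Fin ν × MultiIndex n r → ℝ) :=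
  LinearEquiv.ofBijective (jetComps hφ hs r hx)
    ⟨jetComps_injective hφ hs r hx, jetComps_surjective hφ hs r hx⟩

lemma contMDiffAt_jetComp_jet [T2Space X] (hφ : φ ∈ IsManifold.maximalAtlas (𝓡 n) ∞ X)
    (hs : IsLocalFrameOn (𝓡 n) F ∞ s φ.source) {r : ℕ} (α : Fin ν) (J : MultiIndex n r)
    (w : Sections n F W) {x : X} (hx : x ∈ φ.source) :
    ContMDiffAt (𝓡 n) 𝓘(ℝ, ℝ) ∞ (fun z => jetComp hs α J z (jet r w z)) x := by
  have h1 := (contDiffAt_multiDeriv (contDiffAt_frameRep hφ hs α w hx) J.1).contMDiffAt.comp x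
    (contMDiffAt_of_mem_maximalAtlas hφ hx)
  refine h1.congr_of_eventuallyEq ?_
  filter_upwards [φ.open_source.mem_nhds hx] with z hz
  exact jetComp_jetAt hφ hs α J hz w

open Classical in
/-- The components of a smooth section of the jet bundle are smooth. -/
lemma contMDiffAt_jetComp [T2Space X] (hφ : φ ∈ IsManifold.maximalAtlas (𝓡 n) ∞ X)
    (hs : IsLocalFrameOn (𝓡 n) F ∞ s φ.source) {r : ℕ} (α : Fin ν) (J : MultiIndex n r)
    (lam : Sections n (JetModel n r F) (JetBundle n F W r)) {x : X} (hx : x ∈ φ.source) :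
    ContMDiffAt (𝓡 n) 𝓘(ℝ, ℝ) ∞ (fun z => jetComp hs α J z (lam z)) x := by
  -- The component functional is regarded as a fibrewise linear map to the trivial line bundle. Its
  -- value `0` off the chart domain is irrelevant, since smoothness is tested at a point of that
  -- domain.
  let A : ∀ z, JetBundle n F W r z →L[ℝ] Bundle.Trivial X ℝ z := fun z =>
    if hz : z ∈ φ.source then
      { toLinearMap := (LinearMap.proj (α, J)) ∘ₗ jetComps hφ hs r hz
        cont := continuous_of_linear_jetBundle (V' := Bundle.Trivial X ℝ) r z _ }
    else 0
  have hA : ∀ z ∈ φ.source, ∀ p, A z p = jetComp hs α J z p := fun z hz p => by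
    simp only [A, dif_pos hz]
    rfl
  have h1 : ∀ lam' : Sections n (JetModel n r F) (JetBundle n F W r),
      ContMDiffAt (𝓡 n) ((𝓡 n).prod 𝓘(ℝ, ℝ)) ∞
        (fun z => TotalSpace.mk' ℝ (E := Bundle.Trivial X ℝ) z (A z (lam' z))) x ↔
      ContMDiffAt (𝓡 n) 𝓘(ℝ, ℝ) ∞ (fun z => jetComp hs α J z (lam' z)) x := fun lam' => by
    rw [Bundle.contMDiffAt_section]
    refine Filter.EventuallyEq.contMDiffAt_iff ?_
    filter_upwards [φ.open_source.mem_nhds hx] with z hz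
    exact hA z hz _
  refine (h1 lam).1 ?_
  -- It suffices to test jet extensions, whose components are partial derivatives of smooth
  -- functions.
  exact (contMDiffAt_hom_of_jets r A x fun w =>
    (h1 (jet r w)).2 (contMDiffAt_jetComp_jet hφ hs α J w hx)).clm_bundle_apply
      lam.contMDiff.contMDiffAt

end FrameComponents

/-! ### Traction fields and their exterior jets in coordinates -/

section LocalExpression

set_option linter.unusedSectionVars false

variable {m : ℕ} {X : Type*} [TopologicalSpace X] [ChartedSpace (Coord (m + 1)) X]
  [IsManifold (𝓡 (m + 1)) ∞ X] [T2Space X]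
  {F : Type*} [NormedAddCommGroup F] [NormedSpace ℝ F] [FiniteDimensional ℝ F]
  {W : X → Type*} [∀ x, AddCommGroup (W x)] [∀ x, Module ℝ (W x)]
  [∀ x, TopologicalSpace (W x)] [TopologicalSpace (TotalSpace F W)]
  [FiberBundle F W] [VectorBundle ℝ F W] [ContMDiffVectorBundle ∞ F W (𝓡 (m + 1))]
  {ν : ℕ} {s : Fin ν → ∀ x, W x} {φ : OpenPartialHomeomorph X (Coord (m + 1))} {r : ℕ}

/-- An `(n - 1)`-form at a point is a combination of the forms `∂ⱼ ⌟ dx`. -/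
lemma eq_sum_coordContr (hφ : φ ∈ IsManifold.maximalAtlas (𝓡 (m + 1)) ∞ X) {x : X}
    (hx : x ∈ φ.source) (η : FormBundle (m + 1) m x) :
    η = ∑ j, contrCoeff j (ContinuousAlternatingMap.compContinuousLinearMap η
      (mfderiv (𝓡 (m + 1)) (𝓡 (m + 1)) φ.symm (φ x) : Coord (m + 1) →L[ℝ] Coord (m + 1)) :
        FormModel (m + 1) m) • coordContr φ j x := by
  set ψ : Coord (m + 1) →L[ℝ] Coord (m + 1) :=
    mfderiv (𝓡 (m + 1)) (𝓡 (m + 1)) φ.symm (φ x)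
  set A : Coord (m + 1) →L[ℝ] Coord (m + 1) := mfderiv (𝓡 (m + 1)) (𝓡 (m + 1)) φ x
  have h1 : ψ.comp A = ContinuousLinearMap.id ℝ _ := mfderiv_symm_comp_mfderiv hφ hx
  let η' : FormModel (m + 1) m := η
  -- The form is carried to `ℝⁿ` by the derivative of the inverse chart, expanded there, and brought
  -- back term by term.
  have h2 := congrArg (ContinuousAlternatingMap.compContinuousLinearMapCLM A)
    (sum_contrCoeff (η'.compContinuousLinearMap ψ))
  rw [map_sum] at h2
  have h3 : (η'.compContinuousLinearMap ψ).compContinuousLinearMap A = η' := by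
    change η'.compContinuousLinearMap (ψ.comp A) = η'
    rw [h1]
    rfl
  exact (h2.trans h3).symm

lemma chartForm_sum_coordContr (hφ : φ ∈ IsManifold.maximalAtlas (𝓡 (m + 1)) ∞ X)
    {y : Coord (m + 1)} (hy : y ∈ φ.target) (a : Fin (m + 1) → ℝ) :
    ContinuousAlternatingMap.compContinuousLinearMap (∑ j, a j • coordContr φ j (φ.symm y))
      (mfderiv (𝓡 (m + 1)) (𝓡 (m + 1)) φ.symm y : Coord (m + 1) →L[ℝ] Coord (m + 1)) =
        ∑ j, a j • (volForm (m + 1)).curryLeft (EuclideanSpace.single j 1) := by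
  set ψ : Coord (m + 1) →L[ℝ] Coord (m + 1) := mfderiv (𝓡 (m + 1)) (𝓡 (m + 1)) φ.symm y
  set A : Coord (m + 1) →L[ℝ] Coord (m + 1) := mfderiv (𝓡 (m + 1)) (𝓡 (m + 1)) φ (φ.symm y)
  have h1 : A.comp ψ = ContinuousLinearMap.id ℝ _ := mfderiv_comp_mfderiv_symm hφ hy
  let κ : FormModel (m + 1) m :=
    ∑ j, a j • (volForm (m + 1)).curryLeft (EuclideanSpace.single j 1)
  have h2 : (∑ j, a j • coordContr φ j (φ.symm y) : FormModel (m + 1) m) =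
      κ.compContinuousLinearMap A :=
    (map_sum (ContinuousAlternatingMap.compContinuousLinearMapCLM A :
      FormModel (m + 1) m →L[ℝ] FormModel (m + 1) m)
        (fun j => a j • (volForm (m + 1)).curryLeft (EuclideanSpace.single j 1)) Finset.univ).symm
  have h3 : (κ.compContinuousLinearMap A).compContinuousLinearMap ψ = κ := by
    change κ.compContinuousLinearMap (A.comp ψ) = κ
    rw [h1]
    rfl
  exact (congrArg (fun η : FormModel (m + 1) m => η.compContinuousLinearMap ψ) h2).trans h3

/-- Fibrewise linear algebra: `σ x` is determined by its values on the basis of jets dual to the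
`e^α_J`, and each value expands in the forms `∂ⱼ ⌟ dx`. The components are chosen point by point,
since any such array is smooth by `TractionField.HasComponents.contMDiffOn`. -/
lemma TractionField.exists_hasComponents (hφ : φ ∈ IsManifold.maximalAtlas (𝓡 (m + 1)) ∞ X)
    (hs : IsLocalFrameOn (𝓡 (m + 1)) F ∞ s φ.source) (σ : TractionField m F W r) :
    ∃ c : Fin ν → MultiIndex (m + 1) r → Fin (m + 1) → X → ℝ, σ.HasComponents hs c := by
  classical
  have key : ∀ x : X, ∃ d : Fin ν → MultiIndex (m + 1) r → Fin (m + 1) → ℝ, x ∈ φ.source →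
      ∀ p : JetBundle (m + 1) F W r x,
        σ x p = ∑ α, ∑ J, ∑ j, (d α J j * jetComp hs α J x p) • coordContr φ j x := by
    intro x
    by_cases hx : x ∈ φ.source
    · let e := jetCompsEquiv hφ hs r hx
      let q : Fin ν × MultiIndex (m + 1) r → FormBundle (m + 1) m x :=
        fun i => σ x (e.symm (Pi.single i 1))
      refine ⟨fun α J j => contrCoeff j (ContinuousAlternatingMap.compContinuousLinearMap (q (α, J))
        (mfderiv (𝓡 (m + 1)) (𝓡 (m + 1)) φ.symm (φ x) : Coord (m + 1) →L[ℝ] Coord (m + 1)) :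
          FormModel (m + 1) m), fun _ p => ?_⟩
      have h1 : p = ∑ i, jetComp hs i.1 i.2 x p • e.symm (Pi.single i 1) := by
        apply e.injective
        rw [map_sum]
        simp only [map_smul, LinearEquiv.apply_symm_apply]
        exact pi_eq_sum_univ' (e p)
      have h2 : σ x p = ∑ i, jetComp hs i.1 i.2 x p • q i := by
        conv_lhs => rw [h1]
        rw [map_sum]
        simp only [map_smul, q]
      rw [h2, Fintype.sum_prod_type]
      refine Finset.sum_congr rfl fun α _ => Finset.sum_congr rfl fun J _ => ?_
      conv_lhs => rw [eq_sum_coordContr hφ hx (q (α, J))]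
      rw [Finset.smul_sum]
      refine Finset.sum_congr rfl fun j _ => ?_
      rw [smul_smul, mul_comm]
    · exact ⟨0, fun h => absurd h hx⟩
  choose d hd using key
  exact ⟨fun α J j x => d x α J j, fun x hx p => hd x hx p⟩

/-- After exchanging sums, the coefficients of `σ · λ` on the forms `∂ⱼ ⌟ dx` are read off directly;
these are the functions whose divergence is `d(σ · λ)`. -/
lemma TractionField.HasComponents.contrCoeff_chartForm
    (hφ : φ ∈ IsManifold.maximalAtlas (𝓡 (m + 1)) ∞ X)
    {hs : IsLocalFrameOn (𝓡 (m + 1)) F ∞ s φ.source} {σ : TractionField m F W r}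
    {c : Fin ν → MultiIndex (m + 1) r → Fin (m + 1) → X → ℝ} (hc : σ.HasComponents hs c)
    (lam : Sections (m + 1) (JetModel (m + 1) r F) (JetBundle (m + 1) F W r))
    {y : Coord (m + 1)} (hy : y ∈ φ.target) (j : Fin (m + 1)) :
    contrCoeff j (chartForm φ (applySection σ lam) y) =
      ∑ α, ∑ J, c α J j (φ.symm y) * jetComp hs α J (φ.symm y) (lam (φ.symm y)) := by
  have h1 : σ (φ.symm y) (lam (φ.symm y)) = ∑ j, (∑ α, ∑ J, c α J j (φ.symm y) *
      jetComp hs α J (φ.symm y) (lam (φ.symm y))) • coordContr φ j (φ.symm y) := by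
    rw [hc _ (φ.map_target hy)]
    simp only [Finset.sum_smul]
    conv_rhs => rw [Finset.sum_comm]
    exact Finset.sum_congr rfl fun α _ => Finset.sum_comm
  have h2 := chartForm_sum_coordContr hφ hy fun j => ∑ α, ∑ J, c α J j (φ.symm y) *
      jetComp hs α J (φ.symm y) (lam (φ.symm y))
  rw [← h1] at h2
  exact (congrArg (contrCoeff j) h2).trans (contrCoeff_sum _ j)

/-- The components of a smooth traction field are smooth. -/
lemma TractionField.HasComponents.contMDiffOn
    (hφ : φ ∈ IsManifold.maximalAtlas (𝓡 (m + 1)) ∞ X)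
    {hs : IsLocalFrameOn (𝓡 (m + 1)) F ∞ s φ.source} {σ : TractionField m F W r}
    {c : Fin ν → MultiIndex (m + 1) r → Fin (m + 1) → X → ℝ} (hc : σ.HasComponents hs c)
    (α : Fin ν) (J : MultiIndex (m + 1) r) (j : Fin (m + 1)) :
    ContMDiffOn (𝓡 (m + 1)) 𝓘(ℝ, ℝ) ∞ (c α J j) φ.source := by
  classical
  intro x hx
  refine ContMDiffAt.contMDiffWithinAt ?_
  -- The inversion argument again: `M z v` is the array of components at `z` of the jet of `S v`,
  -- equal to `v` at `x`, while `L z v` is the `j`-th coefficient of `σ · jʳ(S v)`. The row `C` of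
  -- components satisfies `C ∘ M = L`.
  obtain ⟨S, hS⟩ := LinearMap.exists_rightInverse_of_surjective (jetComps hφ hs r hx ∘ₗ jetAt r x)
    (LinearMap.range_eq_top.2 ((jetComps_surjective hφ hs r hx).comp (jetAt_surjective r x)))
  obtain ⟨M, hM, hMv⟩ := exists_contMDiffAt_clm (n := m + 1)
    (E := Fin ν × MultiIndex (m + 1) r → ℝ) (H := Fin ν × MultiIndex (m + 1) r → ℝ) (x := x)
    (U := φ.source)
    (fun z v i => jetComp hs i.1 i.2 z (jet r (S v) z))
    (fun v => contMDiffAt_pi_space.2 fun i => contMDiffAt_jetComp_jet hφ hs i.1 i.2 (S v) hx)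
    (fun z hz => (jetComps hφ hs r hz ∘ₗ jetAt r z ∘ₗ S).isLinear)
  have hcoeff : ∀ v, ∀ z ∈ φ.source,
      contrCoeff j (chartForm φ (applySection σ (jet r (S v))) (φ z)) =
        ∑ i : Fin ν × MultiIndex (m + 1) r, c i.1 i.2 j z * M z v i := fun v z hz => by
    rw [hc.contrCoeff_chartForm hφ _ (φ.map_source hz), φ.left_inv hz, Fintype.sum_prod_type,
      hMv z hz]
  obtain ⟨L, hL, hLv⟩ := exists_contMDiffAt_clm (n := m + 1)
    (E := Fin ν × MultiIndex (m + 1) r → ℝ) (H := ℝ) (x := x)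
    (U := φ.source)
    (fun z v => contrCoeff j (chartForm φ (applySection σ (jet r (S v))) (φ z)))
    (fun v => ((contrCoeff j).contDiff.contDiffAt.comp (φ x)
      (contDiffAt_chartForm hφ (applySection σ (jet r (S v))) hx)).contMDiffAt.comp x
        (contMDiffAt_of_mem_maximalAtlas hφ hx))
    (fun z hz => by
      constructor
      · intro v w
        rw [hcoeff _ z hz, hcoeff _ z hz, hcoeff _ z hz, ← Finset.sum_add_distrib]
        exact Finset.sum_congr rfl fun i _ => by rw [map_add, Pi.add_apply, mul_add]
      · intro a v
        rw [hcoeff _ z hz, hcoeff _ z hz, smul_eq_mul, Finset.mul_sum]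
        exact Finset.sum_congr rfl fun i _ => by
          rw [map_smul, Pi.smul_apply, smul_eq_mul]; ring)
  let C : X → (Fin ν × MultiIndex (m + 1) r → ℝ) →L[ℝ] ℝ := fun z =>
    ∑ i : Fin ν × MultiIndex (m + 1) r, c i.1 i.2 j z • ContinuousLinearMap.proj i
  have hC : ContMDiffAt (𝓡 (m + 1)) 𝓘(ℝ, (Fin ν × MultiIndex (m + 1) r → ℝ) →L[ℝ] ℝ) ∞ C x := by
    refine contMDiffAt_of_comp_eq hM hL ?_ ?_
    · ext1 v
      rw [hMv x hx]
      exact LinearMap.congr_fun hS v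
    · filter_upwards [φ.open_source.mem_nhds hx] with z hz v
      rw [hLv z hz, hcoeff v z hz]
      simp [C]
  -- A single entry of the row is its value on a standard basis vector.
  refine (hC.clm_apply (contMDiffAt_const (c :=
    (Pi.single (α, J) 1 : Fin ν × MultiIndex (m + 1) r → ℝ)))).congr_of_eventuallyEq (Filter.Eventually.of_forall fun z => ?_)
  simp [C, Pi.single_apply]

/-- The exterior jet of a traction field in coordinates. -/
lemma IsExteriorJetOf.hasComponents (hφ : φ ∈ IsManifold.maximalAtlas (𝓡 (m + 1)) ∞ X)
    {hs : IsLocalFrameOn (𝓡 (m + 1)) F ∞ s φ.source} {σ : TractionField m F W r}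
    {τ : StressField m F W r} (hτ : IsExteriorJetOf σ τ)
    {c : Fin ν → MultiIndex (m + 1) r → Fin (m + 1) → X → ℝ} (hc : σ.HasComponents hs c) :
    τ.HasComponents hs (fun α J x => ∑ j, pderiv j (fun y => c α J j (φ.symm y)) (φ x)) c := by
  intro x hx lam
  have hinv := φ.left_inv hx
  have hxt := φ.map_source hx
  have h1 : τ x (jet 1 lam x) = (∑ j, pderiv j
      (fun z => contrCoeff j (chartForm φ (applySection σ lam) z)) (φ x)) • coordVol φ x := by
    rw [hτ lam x]
    refine (extDer_eq_of_mem_maximalAtlas hφ (applySection σ lam) hx).trans ?_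
    rw [extDeriv_eq_sum_pderiv (differentiableAt_chartForm hφ (applySection σ lam) hx)]
    rfl
  have hdiff : ∀ f : X → ℝ, ContMDiffAt (𝓡 (m + 1)) 𝓘(ℝ, ℝ) ∞ f x →
      DifferentiableAt ℝ (fun y => f (φ.symm y)) (φ x) := fun f hf => by
    have h2 : ContMDiffAt (𝓡 (m + 1)) 𝓘(ℝ, ℝ) ∞ f (φ.symm (φ x)) := by rwa [hinv]
    have h3 := h2.comp (φ x) (contMDiffAt_symm_of_mem_maximalAtlas hφ hxt)
    exact (contMDiffAt_iff_contDiffAt.1 h3).differentiableAt (by simp)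
  -- The array `c` is arbitrary, but representing a smooth `σ` forces its entries to be smooth.
  have hcd : ∀ α J j, DifferentiableAt ℝ (fun y => c α J j (φ.symm y)) (φ x) := fun α J j =>
    hdiff _ ((hc.contMDiffOn hφ α J j).contMDiffAt (φ.open_source.mem_nhds hx))
  have hld : ∀ α J, DifferentiableAt ℝ
      (fun y => jetComp hs α J (φ.symm y) (lam (φ.symm y))) (φ x) := fun α J =>
    hdiff (fun z => jetComp hs α J z (lam z)) (contMDiffAt_jetComp hφ hs α J lam hx)
  have h4 : ∀ j, pderiv j (fun z => contrCoeff j (chartForm φ (applySection σ lam) z)) (φ x) =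
      ∑ α, ∑ J, (pderiv j (fun y => c α J j (φ.symm y)) (φ x) * jetComp hs α J x (lam x) +
        c α J j x * pderiv j (fun y => jetComp hs α J (φ.symm y) (lam (φ.symm y))) (φ x)) := by
    intro j
    have h5 : (fun z => contrCoeff j (chartForm φ (applySection σ lam) z)) =ᶠ[𝓝 (φ x)]
        fun y => ∑ α, ∑ J, c α J j (φ.symm y) * jetComp hs α J (φ.symm y) (lam (φ.symm y)) := by
      filter_upwards [φ.open_target.mem_nhds hxt] with y hy
      exact hc.contrCoeff_chartForm hφ lam hy j
    have h6 : ∀ α J, DifferentiableAt ℝ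
        (fun y => c α J j (φ.symm y) * jetComp hs α J (φ.symm y) (lam (φ.symm y))) (φ x) :=
      fun α J => (hcd α J j).mul (hld α J)
    -- The product rule for `σ^{Jj}_α λ^α_J`: differentiating the first factor gives the coefficient
    -- of `e^α_J`, and differentiating the second gives that of `e^α_J ⊗ ∂ⱼ`.
    rw [(pderiv_congr h5 j).eq_of_nhds, pderiv,
      fderiv_fun_sum fun α _ => DifferentiableAt.fun_sum fun J _ => h6 α J, sum_apply]
    refine Finset.sum_congr rfl fun α _ => ?_
    rw [fderiv_fun_sum fun J _ => h6 α J, sum_apply]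
    refine Finset.sum_congr rfl fun J _ => ?_
    have h7 : jetComp hs α J (φ.symm (φ x)) (lam (φ.symm (φ x))) = jetComp hs α J x (lam x) :=
      congrArg (fun z => jetComp hs α J z (lam z)) hinv
    rw [fderiv_fun_mul (hcd α J j) (hld α J), h7]
    simp only [add_apply, smul_apply, smul_eq_mul, hinv, pderiv]
    ring
  rw [h1]
  congr 1
  simp only [h4]
  rw [Finset.sum_comm]
  refine Finset.sum_congr rfl fun α _ => ?_
  rw [Finset.sum_comm]
  refine Finset.sum_congr rfl fun J _ => ?_
  rw [Finset.sum_add_distrib, Finset.sum_mul]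

end LocalExpression

end HyperStress

end

/-! ### Assembly of the proposition -/

theorem mainTheorem4 {m : ℕ} {X : Type*} [TopologicalSpace X] [ChartedSpace (Coord (m + 1)) X]
    [IsManifold (𝓡 (m + 1)) ∞ X] [T2Space X]
    {F : Type*} [NormedAddCommGroup F] [NormedSpace ℝ F] [FiniteDimensional ℝ F]
    {W : X → Type*} [∀ x, AddCommGroup (W x)] [∀ x, Module ℝ (W x)]
    [∀ x, TopologicalSpace (W x)] [TopologicalSpace (TotalSpace F W)]
    [FiberBundle F W] [VectorBundle ℝ F W] [ContMDiffVectorBundle ∞ F W (𝓡 (m + 1))] (r : ℕ) :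
    ∃ 𝔡 : TractionField m F W r →ₗ[ℝ] StressField m F W r,
      -- it is a first-order differential operator
      IsDiffOp 1 𝔡 ∧
      -- `𝔡 σ` is characterized by `𝔡 σ · j¹λ = d(σ · λ)`
      (∀ σ, IsExteriorJetOf σ (𝔡 σ)) ∧
      (∀ σ τ, IsExteriorJetOf σ τ → τ = 𝔡 σ) ∧
      -- it commutes with pullbacks along vector bundle maps `Φ` that are isomorphisms on fibres
      -- and cover local diffeomorphisms `φ`
      (∀ {X' : Type*} [TopologicalSpace X'] [ChartedSpace (Coord (m + 1)) X']
        [IsManifold (𝓡 (m + 1)) ∞ X'] [T2Space X']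
        {F' : Type*} [NormedAddCommGroup F'] [NormedSpace ℝ F'] [FiniteDimensional ℝ F']
        {W' : X' → Type*} [∀ x, AddCommGroup (W' x)] [∀ x, Module ℝ (W' x)]
        [∀ x, TopologicalSpace (W' x)] [TopologicalSpace (TotalSpace F' W')]
        [FiberBundle F' W'] [VectorBundle ℝ F' W'] [ContMDiffVectorBundle ∞ F' W' (𝓡 (m + 1))]
        (φ : X → X') (_ : IsLocalDiffeomorph (𝓡 (m + 1)) (𝓡 (m + 1)) ∞ φ)
        (Φ : ∀ x, W x ≃ₗ[ℝ] W' (φ x))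
        (_ : ContMDiff ((𝓡 (m + 1)).prod 𝓘(ℝ, F)) ((𝓡 (m + 1)).prod 𝓘(ℝ, F')) ∞
          (fun p : TotalSpace F W => TotalSpace.mk' F' (φ p.1) (Φ p.1 p.2)))
        (σ : TractionField m F W r) (σ' : TractionField m F' W' r) (τ' : StressField m F' W' r),
        FormRel φ (JetRel φ (fun x w w' => Φ x w = w') r) (fun x p => σ x p) (fun x p => σ' x p) →
        IsExteriorJetOf σ' τ' →
        FormRel φ (JetRel φ (JetRel φ (fun x w w' => Φ x w = w') r) 1)
          (fun x p => 𝔡 σ x p) (fun x p => τ' x p)) ∧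
      -- the local representation, in a chart `φ` and a local frame `s` of `W`
      (∀ (φ : OpenPartialHomeomorph X (Coord (m + 1)))
        (_ : φ ∈ IsManifold.maximalAtlas (𝓡 (m + 1)) ∞ X)
        {ν : ℕ} {s : Fin ν → ∀ x, W x} (hs : IsLocalFrameOn (𝓡 (m + 1)) F ∞ s φ.source)
        (σ : TractionField m F W r),
        (∃ c : Fin ν → MultiIndex (m + 1) r → Fin (m + 1) → X → ℝ,
          (∀ α J j, ContMDiffOn (𝓡 (m + 1)) 𝓘(ℝ, ℝ) ∞ (c α J j) φ.source) ∧
          σ.HasComponents hs c) ∧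
        ∀ c, σ.HasComponents hs c →
          (𝔡 σ).HasComponents hs
            (fun α J x => ∑ j, pderiv j (fun y => c α J j (φ.symm y)) (φ x)) c) := by
  refine ⟨exteriorJet, isDiffOp_exteriorJet, isExteriorJetOf_exteriorJet,
    fun σ τ h => h.unique (isExteriorJetOf_exteriorJet σ), ?_, ?_⟩
  · intro X' _ _ _ _ F' _ _ _ W' _ _ _ _ _ _ _ φ hφ Φ _ σ σ' τ' h hτ'
    exact exteriorJet_natural hφ.contMDiff _ h (isExteriorJetOf_exteriorJet σ) hτ'
  · intro φ hφ ν s hs σ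
    obtain ⟨c, hc⟩ := TractionField.exists_hasComponents hφ hs σ
    exact ⟨⟨c, fun α J j => hc.contMDiffOn hφ α J j, hc⟩,
      fun c' hc' => (isExteriorJetOf_exteriorJet σ).hasComponents hφ hc'⟩
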